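/- Let $f:U'\to U$ be a generalized polynomial-like map of degree $d>1$: $U\subset\mathbb C$ is open and conformally isomorphic to the unit disk $\mathbb D$; $U'=U_1\cup\dots\cup U_N$ is a disjoint union of open sets conformally isomorphic to $\mathbb D$; the closure of $U'$ is compact and contained in $U$; $f$ is holomorphic and proper; and $d$ is the sum of the degrees of the restrictions $f|:U_i\to U$. Let $K_f=\{z\in U' : f^n(z)\in U'\ \forall n\}$ and $J_f=\partial K_f$, and suppose that $K_f=J_f$ is a Cantor set containing all critical points of $f$. For $k\ge 0$, let $f^{-k}(U)$ be the set of points at which $f^k$ is defined with value in $U$. Let $w\in U\setminus U'$ have the $d$ distinct preimages $w_0,\dots,w_{d-1}\in U'$, let $\phi:\mathbb D\to U\setminus J_f$ be a holomorphic universal covering with $\phi(0)=w$, and let $g_0,\dots,g_{d-1}:\mathbb D\to\mathbb D$ be holomorphic maps with $f\circ\phi\circ g_j=\phi$ and $\phi(g_j(0))=w_j$. Let $\Gamma$ be the group of deck transformations of $\phi$. For a block $\epsilon^k=(\epsilon_1,\dots,\epsilon_k)\in\{0,\dots,d-1\}^k$ write $\sigma(\epsilon^k)=(\epsilon_2,\dots,\epsilon_k)$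 and $\epsilon^{k-1}=(\epsilon_1,\dots,\epsilon_{k-1})$. Let $\gamma_l^{\epsilon^k}\in\Gamma$ ($k\ge1$, $1\le l\le k$, $\epsilon^k$ any block of length $k$) be any family such that the sets $$V_{\epsilon^k}=\gamma_1^{\epsilon^k}\circ g_{\epsilon_1}\circ\dots\circ\gamma_k^{\epsilon^k}\circ g_{\epsilon_k}(\mathbb D)$$ satisfy: 1. $V_{\epsilon^k}\subset V_{\epsilon^{k-1}}$ for all $k\ge2$ and all $\epsilon^k$; 2. $\gamma_l^{\epsilon^k}=\gamma_{l-1}^{\sigma(\epsilon^k)}$ for all $k\ge2$, all $\epsilon^k$ and $2\le l\le k$; 3. for all $k\ge1$ and all $\epsilon^k,\hat\epsilon^k$: if $\phi(V_{\epsilon^k})=\phi(V_{\hat\epsilon^k})$, then $V_{\epsilon^k}=V_{\hat\epsilon^k}$. Then the following hold. (a) If $k\ge1$, $V_{\epsilon^k}=V_{\hat\epsilon^k}$ and $\epsilon_1\ne\hat\epsilon_1$, then there is a connected component $W$ of $f^{-k}(U)$ with $\phi(V_{\epsilon^k})=W\setminus J_f$, and $W$ contains a critical point of $f$. (b) For every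 infinite sequence $\epsilon=(\epsilon_1,\epsilon_2,\dots)\in\{0,\dots,d-1\}^{\mathbb N}$ the set $\bigcap_{k\ge1}\overline{\phi(V_{\epsilon^k})}$, where $\epsilon^k=(\epsilon_1,\dots,\epsilon_k)$, consists of exactly one point $\pi(\epsilon)$, and $\pi(\epsilon)\in J_f$. If $\pi(\epsilon)=\pi(\hat\epsilon)=z$ and $\epsilon_1\ne\hat\epsilon_1$, then $z$ is a critical point of $f$. -/

import Mathlib

open Set Metric

noncomputable section

namespace PolyLike

/-- The open unit disk of the complex plane. -/
abbrev disk : Set ℂ := ball (0 : ℂ) 1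

/-- `A` is an open subset of the plane that is conformally isomorphic to the unit disk. -/
def IsConformalDisk (A : Set ℂ) : Prop :=
  IsOpen A ∧ ∃ ψ : ℂ → ℂ, DifferentiableOn ℂ ψ disk ∧ BijOn ψ disk A

/-- The holomorphic map `f : A → B` has degree `e`: every point of `B` has exactly `e` preimages
in `A`, counted with multiplicity. -/
def HasDegree (f : ℂ → ℂ) (A B : Set ℂ) (e : ℕ) : Prop :=
  ∀ b ∈ B, (A ∩ f ⁻¹' {b}).Finite ∧
    ∑ᶠ z ∈ A ∩ f ⁻¹' {b}, analyticOrderNatAt (fun x => f x - b) z = e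

/-- `f : U' → U` is a generalized polynomial-like map of degree `d`, the disks `Ui i` being the
connected components of `U'`. Only the values of `f` on `U'` matter. -/
structure IsGenPolyLike {N : ℕ} (f : ℂ → ℂ) (U' U : Set ℂ) (Ui : Fin N → Set ℂ) (d : ℕ) :
    Prop where
  disk_range : IsConformalDisk U
  disk_piece : ∀ i, IsConformalDisk (Ui i)
  disjoint_piece : ∀ i j, i ≠ j → Disjoint (Ui i) (Ui j)
  domain_eq : U' = ⋃ i, Ui i
  compact_closure : IsCompact (closure U')
  closure_subset : closure U' ⊆ U
  holo : DifferentiableOn ℂ f U'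
  proper : ∃ h : MapsTo f U' U, IsProperMap (h.restrict f U' U)
  degree : ∃ e : Fin N → ℕ, (∀ i, HasDegree f (Ui i) U (e i)) ∧ d = ∑ i, e i

/-- The filled-in Julia set `K_f`. -/
def filledJulia (f : ℂ → ℂ) (U' : Set ℂ) : Set ℂ := {z | ∀ n : ℕ, f^[n] z ∈ U'}

/-- The Julia set `J_f`, the topological boundary of `K_f`. -/
def julia (f : ℂ → ℂ) (U' : Set ℂ) : Set ℂ := frontier (filledJulia f U')

/-- Cantor sets: nonempty, compact, perfect and totally disconnected. -/
def IsCantorSet (K : Set ℂ) : Prop :=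
  K.Nonempty ∧ IsCompact K ∧ Perfect K ∧ IsTotallyDisconnected K

/-- `c` is a critical point of `f : U' → U`. -/
def IsCriticalPoint (f : ℂ → ℂ) (U' : Set ℂ) (c : ℂ) : Prop := c ∈ U' ∧ deriv f c = 0

/-- The set `f^{-k}(U)` of the points at which the `k`-th iterate of `f : U' → U` is defined
(with values in `U`). -/
def pullback (f : ℂ → ℂ) (U' U : Set ℂ) : ℕ → Set ℂ
  | 0 => U
  | k + 1 => {z | z ∈ U' ∧ f z ∈ pullback f U' U k}

/-- `W` is a connected component of the set `A`. -/
def IsComponentOf (W A : Set ℂ) : Prop := ∃ z ∈ A, W = connectedComponentIn A z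

/-- `φ` is a holomorphic covering of `A` by the unit disk. The disk being simply connected, this
is a universal covering. -/
structure IsUniversalCovering (φ : ℂ → ℂ) (A : Set ℂ) : Prop where
  holo : DifferentiableOn ℂ φ disk
  surj : SurjOn φ disk A
  covering : ∃ h : MapsTo φ disk A, IsCoveringMap (h.restrict φ disk A)

/-- `g` is a holomorphic self-map of the disk that lifts an inverse branch of `f`,
that is, `f ∘ φ ∘ g = φ` where `φ ∘ g` takes its values in the domain of `f`. -/
structure IsInverseLift (f : ℂ → ℂ) (U' : Set ℂ) (φ g : ℂ → ℂ) : Prop where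
  holo : DifferentiableOn ℂ g disk
  mapsTo : MapsTo g disk disk
  mem_domain : ∀ z ∈ disk, φ (g z) ∈ U'
  lift : ∀ z ∈ disk, f (φ (g z)) = φ z

/-- `γ` is a deck transformation of `φ`: an automorphism of the disk with `φ ∘ γ = φ`. -/
structure IsDeck (φ γ : ℂ → ℂ) : Prop where
  holo : DifferentiableOn ℂ γ disk
  bij : BijOn γ disk disk
  comm : ∀ z ∈ disk, φ (γ z) = φ z

/-- For a block `ε` of length `k`, the composition
`δ 0 ∘ g (ε 0) ∘ δ 1 ∘ g (ε 1) ∘ ⋯ ∘ δ (k-1) ∘ g (ε (k-1))`. -/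
def chain {d : ℕ} (g : Fin d → ℂ → ℂ) :
    (k : ℕ) → (Fin k → Fin d) → (Fin k → ℂ → ℂ) → ℂ → ℂ
  | 0, _, _ => id
  | k + 1, ε, δ => fun z => δ 0 (g (ε 0) (chain g k (Fin.tail ε) (Fin.tail δ) z))

/-- The set `V_ε` of a block `ε` of length `k`, for the family `γ`. -/
def block {d : ℕ} (g : Fin d → ℂ → ℂ) (γ : (k : ℕ) → (Fin k → Fin d) → Fin k → ℂ → ℂ)
    (k : ℕ) (ε : Fin k → Fin d) : Set ℂ :=
  chain g k ε (γ k ε) '' disk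

/-- The three properties required of the deck transformations `γ k ε l` (blocks `ε` of length `k`,
positions `l < k`): the sets `V_ε` are nested, the family is shift invariant, and sets `V_ε` with
the same image under `φ` coincide. `Fin.init` forgets the last letter of a block, `Fin.tail` the
first one. -/
structure IsGoodFamily {d : ℕ} (φ : ℂ → ℂ) (g : Fin d → ℂ → ℂ)
    (γ : (k : ℕ) → (Fin k → Fin d) → Fin k → ℂ → ℂ) : Prop where
  deck : ∀ k ε l, IsDeck φ (γ k ε l)
  nested : ∀ k, 1 ≤ k → ∀ ε : Fin (k + 1) → Fin d,
    block g γ (k + 1) ε ⊆ block g γ k (Fin.init ε)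
  shift : ∀ k, 1 ≤ k → ∀ (ε : Fin (k + 1) → Fin d) (l : Fin k),
    EqOn (γ (k + 1) ε l.succ) (γ k (Fin.tail ε) l) disk
  merged : ∀ k, 1 ≤ k → ∀ ε ε' : Fin k → Fin d,
    φ '' block g γ k ε = φ '' block g γ k ε' → block g γ k ε = block g γ k ε'

/-- The intersection over `k ≥ 1` of the closures of the sets `φ (V_{ε^k})`, where `ε^k` is the
block of the first `k` letters of the infinite sequence `ε`. -/
def codeSet {d : ℕ} (φ : ℂ → ℂ) (g : Fin d → ℂ → ℂ)
    (γ : (k : ℕ) → (Fin k → Fin d) → Fin k → ℂ → ℂ) (ε : ℕ → Fin d) : Set ℂ :=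
  ⋂ k : ℕ, ⋂ _ : 1 ≤ k, closure (φ '' block g γ k (fun i : Fin k => ε i))

end PolyLike

end

namespace PolyLike
open Topology Filter Complex

/-! Write `K` for the filled Julia set, here equal to its boundary. A composition `chain` of inverse
branches satisfies `f^[k] ∘ φ ∘ chain = φ`, and `f^[k]` is locally injective off `K`, because all
critical points lie in `K`. Since `K` is compact and totally disconnected, removing it from a
component `W` of `f⁻ᵏ(U)` leaves a connected set. Lifting paths through `φ` then shows that `φ(V_ε)`
is all of `W \ K` (`exists_component_image_chain`).

For (a), suppose `W` contains no critical point. Then `f` maps `W` properly and without branching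
onto a component of `f⁻ᵏ⁺¹(U)`, which has no holes, so `f` is injective on `W` (`injOn_component`).
Applying `f` and the merging property, the two shifted blocks define the same set. A point `y` of it
gives two points `φ (g i y)`, `φ (g j y)` of `W` over `φ y`, with `i`, `j` the two distinct first
letters. Injectivity makes them equal, but two lifts of inverse branches that differ at `0` never
agree (`φ_g_ne`).

For (b), the closures of the components `W k` attached to a sequence are compact, connected and
nested, and their intersection lies in `K`, hence is a point. If two sequences with different first
letters give the same `z`, their components agree at each level, so (a) puts a critical point in
every `W k`; by compactness a zero of `f'` survives in the intersection, which is `{z}`.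

Two facts of plane topology carry the argument. `injOn_of_proper_of_isFull` replaces simple
connectivity by `IsFull`: sections are built square by square on a grid, and winding numbers, in the
form of continuous logarithms, exclude monodromy. `isPreconnected_diff` rests on Eilenberg's
criterion. -/

/-! ### Uniqueness of lifts, and logarithms on compact subsets of full sets. -/

/-- `W` is full: it has no holes. -/
def IsFull (W : Set ℂ) : Prop :=
  ∀ O : Set ℂ, IsOpen O → Bornology.IsBounded O → frontier O ⊆ W → O ⊆ W

/-- Every point of `W` has a neighbourhood on which `f` is injective. -/
def LocInjOn (f : ℂ → ℂ) (W : Set ℂ) : Prop :=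
  ∀ x ∈ W, ∃ N ∈ 𝓝 x, InjOn f N

/-- Uniqueness of lifts through a locally injective map. -/
theorem LocInjOn.eqOn_of_comp_eqOn {X : Type*} [TopologicalSpace X] {f : ℂ → ℂ} {W : Set ℂ}
    (hf : LocInjOn f W) {S : Set X} (hS : IsPreconnected S) {u v : X → ℂ}
    (hu : ContinuousOn u S) (hv : ContinuousOn v S) (huW : MapsTo u S W)
    (h : ∀ x ∈ S, f (u x) = f (v x)) {x₀ : X} (hx₀ : x₀ ∈ S) (h₀ : u x₀ = v x₀) :
    EqOn u v S := by
  have key : ∀ x ∈ S, ∀ᶠ y in 𝓝[S] x, (u x = v x ↔ u y = v y) := by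
    intro x hx
    by_cases hxy : u x = v x
    · obtain ⟨N, hN, hinj⟩ := hf (u x) (huW hx)
      have h1 : ∀ᶠ y in 𝓝[S] x, u y ∈ N := (hu x hx) hN
      have h2 : ∀ᶠ y in 𝓝[S] x, v y ∈ N := (hv x hx) (by rwa [← hxy])
      filter_upwards [h1, h2, self_mem_nhdsWithin] with y h1 h2 hy
      exact ⟨fun _ => hinj h1 h2 (h y hy), fun _ => hxy⟩
    · have : ∀ᶠ y in 𝓝[S] x, u y ≠ v y := by
        have h1 : Tendsto (fun y => u y - v y) (𝓝[S] x) (𝓝 (u x - v x)) := (hu x hx).sub (hv x hx)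
        filter_upwards [h1.eventually_ne (sub_ne_zero.2 hxy)] with y hy
        exact sub_ne_zero.1 hy
      filter_upwards [this] with y hy
      exact ⟨fun h => absurd h hxy, fun h => absurd h hy⟩
  intro y hy
  exact (hS.induction₂ (fun x y => (u x = v x ↔ u y = v y))
    (fun x hx => key x hx)
    (fun x y z _ _ _ h1 h2 => h1.trans h2) (fun x y _ _ h => h.symm) hx₀ hy).1 h₀

theorem exists_injOn_nhds_of_hasStrictDerivAt {f : ℂ → ℂ} {f' x : ℂ} (h : HasStrictDerivAt f f' x)
    (h0 : f' ≠ 0) : ∃ N ∈ 𝓝 x, InjOn f N := by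
  let e := (h.hasStrictFDerivAt_equiv h0).toOpenPartialHomeomorph f
  exact ⟨e.source, e.open_source.mem_nhds
    (h.hasStrictFDerivAt_equiv h0).mem_toOpenPartialHomeomorph_source, e.injOn⟩

theorem locInjOn_exp : LocInjOn exp univ := fun x _ =>
  exists_injOn_nhds_of_hasStrictDerivAt (hasStrictDerivAt_exp x) (exp_ne_zero x)

/-- Two continuous logarithms of the same function differ by a constant. -/
theorem sub_eq_sub_of_exp_eq {X : Type*} [TopologicalSpace X] {S : Set X} (hS : IsPreconnected S)
    {u v : X → ℂ} (hu : ContinuousOn u S) (hv : ContinuousOn v S)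
    (h : ∀ x ∈ S, exp (u x) = exp (v x)) {x y : X} (hx : x ∈ S) (hy : y ∈ S) :
    u x - v x = u y - v y := by
  have h1 := locInjOn_exp.eqOn_of_comp_eqOn hS hu (v := fun t => v t + (u x - v x))
    (by fun_prop) (fun _ _ => mem_univ _)
    (fun t ht => by
      rw [exp_add, exp_sub, h t ht, h x hx, div_self (exp_ne_zero _), mul_one]) hx (by ring)
  have := h1 hy
  simp only at this
  rw [this]; ring

theorem mem_slitPlane_of_norm_sub_one_lt {w : ℂ} (h : ‖w - 1‖ < 1) : w ∈ slitPlane := by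
  have := mem_slitPlane_of_norm_lt_one h
  simpa using this

theorem notMem_of_mem_frontier_connectedComponentIn {D : Set ℂ} (hD : IsOpen D) {x y : ℂ}
    (hy : y ∈ frontier (connectedComponentIn D x)) : y ∉ D := by
  intro hyD
  obtain ⟨q, hq1, hq2⟩ := mem_closure_iff.1 hy.1 _ hD.connectedComponentIn
    (mem_connectedComponentIn hyD)
  rw [hD.connectedComponentIn.frontier_eq, connectedComponentIn_eq hq2,
    ← connectedComponentIn_eq hq1] at hy
  exact hy.2 (mem_connectedComponentIn hyD)

/-- On a compact subset of a full set, `z - p` has a continuous logarithm. -/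
theorem IsFull.exists_log {Ω K : Set ℂ} (hΩ : IsFull Ω) (hK : IsCompact K) (hKΩ : K ⊆ Ω)
    {p : ℂ} (hp : p ∉ Ω) :
    ∃ l : ℂ → ℂ, ContinuousOn l K ∧ ∀ z ∈ K, exp (l z) = z - p := by
  set O := connectedComponentIn Kᶜ p with hO
  have hpK : p ∈ Kᶜ := fun h => hp (hKΩ h)
  have hOo : IsOpen O := hK.isClosed.isOpen_compl.connectedComponentIn
  have hpO : p ∈ O := mem_connectedComponentIn hpK
  have hOK : O ⊆ Kᶜ := connectedComponentIn_subset _ _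
  have hfr : frontier O ⊆ K := fun x hx => by
    by_contra hxK
    exact notMem_of_mem_frontier_connectedComponentIn hK.isClosed.isOpen_compl hx hxK
  have hunb : ¬ Bornology.IsBounded O := fun hb => hp (hΩ O hOo hb (hfr.trans hKΩ) hpO)
  obtain ⟨R, hR⟩ := hK.isBounded.subset_ball (0 : ℂ)
  have hfar : ∃ q ∈ O, R ≤ ‖q‖ := by
    by_contra! hcon
    exact hunb (isBounded_ball.subset (s := O) (t := ball 0 R)
      (fun q hq => by simpa using hcon q hq))
  obtain ⟨q, hqO, hqR⟩ := hfar
  -- Having a logarithm of `(z - a) / (z - b)` on `K` is an equivalence relation between `a` and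
  -- `b`. Nearby points are related, so the connected set `O` is a single class, and the pole can be
  -- moved from `p` to `q`, far from `K`.
  have hP : ∃ l : ℂ → ℂ, ContinuousOn l K ∧ ∀ z ∈ K, exp (l z) = (z - p) / (z - q) := by
    refine (isPreconnected_connectedComponentIn (x := p) (F := Kᶜ)).induction₂
      (fun a b => ∃ l : ℂ → ℂ, ContinuousOn l K ∧ ∀ z ∈ K, exp (l z) = (z - a) / (z - b))
      ?_ ?_ ?_ hpO hqO
    · intro x hx
      have hxK : x ∈ Kᶜ := hOK hx
      obtain ⟨δ, hδ, hball⟩ := Metric.isOpen_iff.1 hK.isClosed.isOpen_compl x hxK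
      filter_upwards [mem_nhdsWithin_of_mem_nhds (ball_mem_nhds x hδ)] with y hy
      have hne : ∀ z ∈ K, z - x ≠ 0 := fun z hz h => hxK (by rwa [← sub_eq_zero.1 h])
      have hsl : ∀ z ∈ K, (z - y) / (z - x) ∈ slitPlane := by
        intro z hz
        apply mem_slitPlane_of_norm_sub_one_lt
        have : (z - y) / (z - x) - 1 = (x - y) / (z - x) := by
          field_simp [hne z hz]; ring
        rw [this, norm_div, div_lt_one (norm_pos_iff.2 (hne z hz))]
        have h1 : ¬ dist z x < δ := fun h => hball h hz
        rw [← dist_eq_norm, ← dist_eq_norm, dist_comm x y]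
        exact lt_of_lt_of_le hy (not_lt.1 h1)
      refine ⟨fun z => - log ((z - y) / (z - x)), ?_, ?_⟩
      · refine (ContinuousOn.clog ?_ hsl).neg
        exact ContinuousOn.div (by fun_prop) (by fun_prop) hne
      · intro z hz
        rw [exp_neg, exp_log (slitPlane_ne_zero (hsl z hz)), inv_div]
    · rintro x y z _ hy _ ⟨l1, h1, e1⟩ ⟨l2, h2, e2⟩
      refine ⟨fun t => l1 t + l2 t, h1.add h2, fun t ht => ?_⟩
      have : t - y ≠ 0 := fun h => hOK hy (by rwa [← sub_eq_zero.1 h])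
      rw [exp_add, e1 t ht, e2 t ht]
      field_simp
    · rintro x y _ _ ⟨l1, h1, e1⟩
      exact ⟨fun t => - l1 t, h1.neg, fun t ht => by rw [exp_neg, e1 t ht, inv_div]⟩
  obtain ⟨l, hl, el⟩ := hP
  have hzR : ∀ z ∈ K, ‖z‖ < R := fun z hz => by simpa using hR hz
  by_cases hKe : K = ∅
  · exact ⟨0, by simp [hKe], by simp [hKe]⟩
  obtain ⟨z₀, hz₀⟩ := nonempty_iff_ne_empty.2 hKe
  have hq0 : q ≠ 0 := by
    rintro rfl
    have := hzR z₀ hz₀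
    simp only [norm_zero] at hqR
    linarith [norm_nonneg z₀]
  have hsl : ∀ z ∈ K, (1 - z / q) ∈ slitPlane := by
    intro z hz
    apply mem_slitPlane_of_norm_sub_one_lt
    have : (1 - z / q) - 1 = - (z / q) := by ring
    rw [this, norm_neg, norm_div, div_lt_one (norm_pos_iff.2 hq0)]
    exact (hzR z hz).trans_le hqR
  refine ⟨fun z => l z + (log (-q) + log (1 - z / q)), ?_, ?_⟩
  · exact hl.add (continuousOn_const.add (ContinuousOn.clog (by fun_prop) hsl))
  · intro z hz
    have hzq : z - q ≠ 0 := fun h => by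
      have := hzR z hz
      rw [sub_eq_zero.1 h] at this
      linarith
    rw [exp_add, exp_add, el z hz, exp_log (neg_ne_zero.2 hq0),
      exp_log (slitPlane_ne_zero (hsl z hz))]
    field_simp
    ring

/-! ### Conformal disks, and components of preimages of full sets, are full. -/

theorem isPreconnected_annulus (r : ℝ) (hr : 0 < r) :
    IsPreconnected {z : ℂ | r < ‖z‖ ∧ ‖z‖ < 1} := by
  have h : {z : ℂ | r < ‖z‖ ∧ ‖z‖ < 1} =
      (fun q : ℝ × ℝ => (q.1 : ℂ) * exp (q.2 * I)) '' (Ioo r 1 ×ˢ univ) := by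
    ext z
    constructor
    · rintro ⟨h1, h2⟩
      exact ⟨(‖z‖, arg z), ⟨⟨h1, h2⟩, mem_univ _⟩, norm_mul_exp_arg_mul_I z⟩
    · rintro ⟨⟨s, t⟩, ⟨⟨h1, h2⟩, -⟩, rfl⟩
      have : ‖(s : ℂ) * exp (t * I)‖ = s := by
        rw [norm_mul, norm_exp_ofReal_mul_I, mul_one, norm_real, Real.norm_of_nonneg]
        simp only at h1
        linarith
      exact ⟨by rw [this]; exact h1, by rw [this]; exact h2⟩
  rw [h]
  exact (isPreconnected_Ioo.prod isPreconnected_univ).image _ (by fun_prop)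

theorem inter_frontier_nonempty_of_isPreconnected {T O : Set ℂ} (hT : IsPreconnected T)
    (hO : IsOpen O) (h1 : (T ∩ O).Nonempty) (h2 : (T ∩ Oᶜ).Nonempty) :
    (T ∩ frontier O).Nonempty := by
  by_contra hcon
  have hcov : T ⊆ O ∪ (closure O)ᶜ := by
    intro x hx
    by_contra h
    rw [mem_union, not_or, mem_compl_iff, not_not] at h
    exact hcon ⟨x, hx, by rw [hO.frontier_eq]; exact ⟨h.2, h.1⟩⟩
  have h3 : (T ∩ (closure O)ᶜ).Nonempty := by
    obtain ⟨x, hx, hxO⟩ := h2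
    exact ⟨x, hx, (hcov hx).resolve_left hxO⟩
  obtain ⟨x, -, hx1, hx2⟩ := hT O (closure O)ᶜ hO isClosed_closure.isOpen_compl hcov h1 h3
  exact hx2 (subset_closure hx1)

theorem bounded_ne_univ {s : Set ℂ} (h : Bornology.IsBounded s) : s ≠ univ := by
  rintro rfl
  exact NormedSpace.unbounded_univ ℝ ℂ h

theorem frontier_nonempty_of_bounded {O : Set ℂ} (hb : Bornology.IsBounded O)
    (hne : O.Nonempty) : (frontier O).Nonempty :=
  nonempty_frontier_iff.2 ⟨hne, bounded_ne_univ hb⟩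

theorem isOpen_image_of_injOn {ψ : ℂ → ℂ} {D s : Set ℂ} (hD : IsOpen D) (hDc : IsPreconnected D)
    (hDn : ∃ x ∈ D, ∃ y ∈ D, x ≠ y)
    (hψ : DifferentiableOn ℂ ψ D) (hinj : InjOn ψ D) (hs : s ⊆ D) (hso : IsOpen s) :
    IsOpen (ψ '' s) := by
  rcases (hψ.analyticOnNhd hD).is_constant_or_isOpen hDc with ⟨w, hw⟩ | h
  · obtain ⟨x, hx, y, hy, hxy⟩ := hDn
    exact absurd (hinj hx hy ((hw x hx).trans (hw y hy).symm)) hxy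
  · exact h s hs hso

theorem IsConformalDisk.isPreconnected {A : Set ℂ} (hA : IsConformalDisk A) :
    IsPreconnected A := by
  obtain ⟨-, ψ, hψ, hbij⟩ := hA
  rw [← hbij.image_eq]
  exact (convex_ball (0 : ℂ) 1).isPreconnected.image _ hψ.continuousOn

/-- Suppose `p` in `O` is missed by `A`. The compact frontier of `O` lies in the image of a smaller
disk of radius `r`; let `K` be the image of the closed one. The bounded component `O₁` of `Kᶜ`
through `p` has frontier in `K`, so it meets, hence contains, the image `N` of the annulus outside
radius `r`. Thus `O₁ ∪ K = O₁ ∪ A` is both closed and open, although bounded. -/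
theorem IsConformalDisk.isFull {A : Set ℂ} (hA : IsConformalDisk A) : IsFull A := by
  obtain ⟨hAo, ψ, hψ, hbij⟩ := hA
  intro O hO hOb hfr p hpO
  by_contra hpA
  have hne : ∃ x ∈ disk, ∃ y ∈ disk, x ≠ y :=
    ⟨0, by simp, (1 / 2 : ℂ), by simp; norm_num, by norm_num⟩
  have hopen : ∀ s ⊆ disk, IsOpen s → IsOpen (ψ '' s) := fun s hs hso =>
    isOpen_image_of_injOn isOpen_ball (convex_ball (0 : ℂ) 1).isPreconnected hne hψ hbij.injOn hs hso
  have hfrc : IsCompact (frontier O) :=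
    isCompact_of_isClosed_isBounded isClosed_frontier
      (hOb.closure.subset frontier_subset_closure)
  obtain ⟨⟨r, hr0, hr1⟩, hr⟩ : ∃ r : {r : ℝ // 0 < r ∧ r < 1},
      frontier O ⊆ ψ '' ball 0 r.1 := by
    have : Nonempty {r : ℝ // 0 < r ∧ r < 1} := ⟨⟨1 / 2, by norm_num, by norm_num⟩⟩
    refine hfrc.elim_directed_cover _
      (fun r => hopen _ (ball_subset_ball r.2.2.le) isOpen_ball) ?_ ?_
    · intro y hy
      obtain ⟨x, hx, rfl⟩ := hbij.surjOn (hfr hy)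
      obtain ⟨t, ht1, ht2⟩ := exists_between (show ‖x‖ < 1 by simpa using hx)
      exact mem_iUnion.2 ⟨⟨t, (norm_nonneg x).trans_lt ht1, ht2⟩, x, by simpa using ht1, rfl⟩
    · intro a b
      refine ⟨⟨max a.1 b.1, lt_max_of_lt_left a.2.1, max_lt a.2.2 b.2.2⟩, ?_, ?_⟩
      · exact image_mono (ball_subset_ball (le_max_left _ _))
      · exact image_mono (ball_subset_ball (le_max_right _ _))
  have hcb : closedBall (0 : ℂ) r ⊆ disk := closedBall_subset_ball hr1
  set K := ψ '' closedBall 0 r with hKdef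
  have hK : IsCompact K := (isCompact_closedBall 0 r).image_of_continuousOn
    (hψ.continuousOn.mono hcb)
  have hKA : K ⊆ A := by rw [← hbij.image_eq]; exact image_mono hcb
  have hpK : p ∈ Kᶜ := fun h => hpA (hKA h)
  set O₁ := connectedComponentIn Kᶜ p
  have hO₁o : IsOpen O₁ := hK.isClosed.isOpen_compl.connectedComponentIn
  have hpO₁ : p ∈ O₁ := mem_connectedComponentIn hpK
  have hO₁O : O₁ ⊆ O := by
    intro x hx
    by_contra hxO
    obtain ⟨y, hy1, hy2⟩ := inter_frontier_nonempty_of_isPreconnected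
      (isPreconnected_connectedComponentIn (x := p) (F := Kᶜ)) hO
      ⟨p, hpO₁, hpO⟩ ⟨x, hx, hxO⟩
    exact connectedComponentIn_subset _ _ hy1 (image_mono ball_subset_closedBall (hr hy2))
  have hO₁b := hOb.subset hO₁O
  have hO₁fr : frontier O₁ ⊆ K := fun x hx => by
    by_contra hxK
    exact notMem_of_mem_frontier_connectedComponentIn hK.isClosed.isOpen_compl hx hxK
  set N := ψ '' {z : ℂ | r < ‖z‖ ∧ ‖z‖ < 1}
  have hNsub : {z : ℂ | r < ‖z‖ ∧ ‖z‖ < 1} ⊆ disk := fun z hz => by simpa using hz.2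
  have hNK : N ⊆ Kᶜ := by
    rintro _ ⟨z, hz, rfl⟩ ⟨x, hx, hxz⟩
    have := hbij.injOn (hcb hx) (hNsub hz) hxz
    subst this
    have h1 : ‖x‖ ≤ r := by simpa using hx
    exact absurd hz.1 (not_lt.2 h1)
  have hAKN : A ⊆ K ∪ N := by
    intro y hy
    obtain ⟨x, hx, rfl⟩ := hbij.surjOn hy
    by_cases h : ‖x‖ ≤ r
    · exact Or.inl ⟨x, by simpa using h, rfl⟩
    · exact Or.inr ⟨x, ⟨not_le.1 h, by simpa using hx⟩, rfl⟩
  have hNO₁ : N ⊆ O₁ := by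
    obtain ⟨y, hy⟩ := frontier_nonempty_of_bounded hO₁b ⟨p, hpO₁⟩
    obtain ⟨q, hqA, hqO⟩ := mem_closure_iff.1 hy.1 A hAo (hKA (hO₁fr hy))
    have hqN : q ∈ N := (hAKN hqA).resolve_left fun h => connectedComponentIn_subset _ _ hqO h
    have hNc : IsPreconnected N := (isPreconnected_annulus r hr0).image _
      (hψ.continuousOn.mono hNsub)
    have := hNc.subset_connectedComponentIn hqN hNK
    rwa [← connectedComponentIn_eq hqO] at this
  have hT : O₁ ∪ K = O₁ ∪ A := by
    apply subset_antisymm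
    · exact union_subset_union_right _ hKA
    · rintro x (hx | hx)
      · exact Or.inl hx
      · exact (hAKN hx).elim Or.inr fun h => Or.inl (hNO₁ h)
  have hclopen : IsClopen (O₁ ∪ K) := by
    refine ⟨?_, ?_⟩
    · have : O₁ ∪ K = closure O₁ ∪ K := by
        apply subset_antisymm
        · exact union_subset_union_left _ subset_closure
        · rintro x (hx | hx)
          · by_cases h : x ∈ O₁
            · exact Or.inl h
            · exact Or.inr (hO₁fr (by rw [hO₁o.frontier_eq]; exact ⟨hx, h⟩))
          · exact Or.inr hx
      rw [this]
      exact isClosed_closure.union hK.isClosed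
    · rw [hT]
      exact hO₁o.union hAo
  exact bounded_ne_univ (hO₁b.union hK.isBounded) (hclopen.eq_univ ⟨p, Or.inl hpO₁⟩)

/-- By the open mapping theorem the frontier of `f '' O` lies in the image of `frontier O`, so
fullness of `W'` puts `f '' O` in `W'`. A component of `D` through a point of `O` cannot remain in
`O`, since its frontier would then lie in `D`; so it meets `frontier O`, which belongs to the given
component. -/
theorem IsFull.connectedComponentIn_preimage {f : ℂ → ℂ} {A W' : Set ℂ} (hA : IsFull A)
    (hAo : IsOpen A) (hAc : IsPreconnected A) (hf : DifferentiableOn ℂ f A) (hW' : IsFull W')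
    (hW'o : IsOpen W') (z : ℂ) :
    IsFull (connectedComponentIn {x | x ∈ A ∧ f x ∈ W'} z) := by
  set D := {x | x ∈ A ∧ f x ∈ W'} with hD
  have hDo : IsOpen D := hf.continuousOn.isOpen_inter_preimage hAo hW'o
  intro O hO hOb hfr x hx
  have hfrD : frontier O ⊆ D := hfr.trans (connectedComponentIn_subset _ _)
  have hOA : O ⊆ A := hA O hO hOb (hfrD.trans fun x hx => hx.1)
  have hcl : closure O ⊆ A := by
    rw [closure_eq_self_union_frontier]
    exact union_subset hOA (hfrD.trans fun x hx => hx.1)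
  have hOD : O ⊆ D := by
    refine fun y hy => ⟨hOA hy, ?_⟩
    rcases (hf.analyticOnNhd hAo).is_constant_or_isOpen hAc with ⟨w, hw⟩ | hopen
    · obtain ⟨u, hu⟩ := frontier_nonempty_of_bounded hOb ⟨y, hy⟩
      rw [hw y (hOA hy), ← hw u (hfrD hu).1]
      exact (hfrD hu).2
    · have hcomp : IsCompact (f '' closure O) :=
        (hOb.isCompact_closure).image_of_continuousOn (hf.continuousOn.mono hcl)
      have hsub : f '' O ⊆ f '' closure O := image_mono subset_closure
      refine hW' (f '' O) (hopen O hOA hO) (hcomp.isBounded.subset hsub) ?_ ⟨y, hy, rfl⟩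
      intro v hv
      rw [(hopen O hOA hO).frontier_eq] at hv
      obtain ⟨u, hu, rfl⟩ := hcomp.isClosed.closure_subset_iff.2 hsub hv.1
      have : u ∈ frontier O := by
        rw [hO.frontier_eq]
        exact ⟨hu, fun h => hv.2 ⟨u, h, rfl⟩⟩
      exact (hfrD this).2
  have hxC : x ∈ connectedComponentIn D x := mem_connectedComponentIn (hOD hx)
  by_cases hsub : connectedComponentIn D x ⊆ O
  · obtain ⟨y, hy⟩ := frontier_nonempty_of_bounded (hOb.subset hsub) ⟨x, hxC⟩
    have h1 := notMem_of_mem_frontier_connectedComponentIn hDo hy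
    have h2 : y ∈ closure O := closure_mono hsub hy.1
    rw [closure_eq_self_union_frontier] at h2
    exact absurd (h2.elim (fun h => hOD h) (fun h => hfrD h)) h1
  · obtain ⟨u, hu, huO⟩ := not_subset.1 hsub
    obtain ⟨y, hy1, hy2⟩ := inter_frontier_nonempty_of_isPreconnected
      (isPreconnected_connectedComponentIn (x := x) (F := D)) hO
      ⟨x, hxC, hx⟩ ⟨u, hu, huO⟩
    rw [connectedComponentIn_eq (hfr hy2), ← connectedComponentIn_eq hy1]
    exact hxC

/-! ### Gluing sections over a union of two open sets. -/

/-- `s` is a continuous section of `f : W → ℂ` over `A`. -/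
structure IsSection (f : ℂ → ℂ) (W A : Set ℂ) (s : ℂ → ℂ) : Prop where
  cont : ContinuousOn s A
  mapsTo : MapsTo s A W
  apply_eq : ∀ x ∈ A, f (s x) = x

/-- Every point of `W` over `A` lies on a section of `f : W → ℂ` over `A`. -/
def HasSections (f : ℂ → ℂ) (W A : Set ℂ) : Prop :=
  ∀ q ∈ W, f q ∈ A → ∃ s, IsSection f W A s ∧ s (f q) = q

theorem LocInjOn.eqOn_sections {f : ℂ → ℂ} {W A B T : Set ℂ} (hf : LocInjOn f W) {s t : ℂ → ℂ}
    (hs : IsSection f W A s) (ht : IsSection f W B t) (hT : IsPreconnected T) (hTA : T ⊆ A)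
    (hTB : T ⊆ B) {x : ℂ} (hx : x ∈ T) (hst : s x = t x) : EqOn s t T :=
  hf.eqOn_of_comp_eqOn hT (hs.cont.mono hTA) (ht.cont.mono hTB) (fun y hy => hs.mapsTo (hTA hy))
    (fun y hy => by rw [hs.apply_eq y (hTA hy), ht.apply_eq y (hTB hy)]) hx hst

/-- Over each component of `A` that meets `B`, choose a section agreeing with `sB` at one common
point. By `H` the overlap of this component with `B` is connected, so agreement propagates over the
whole overlap. Components that miss `B` keep `sA`. -/
theorem HasSections.glue {f : ℂ → ℂ} {W A B : Set ℂ} (hf : LocInjOn f W) (hAo : IsOpen A)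
    (hBo : IsOpen B) (hA : HasSections f W A) {sA sB : ℂ → ℂ} (hsA : IsSection f W A sA)
    (hsB : IsSection f W B sB)
    (H : ∀ x ∈ A ∩ B, ∀ y ∈ A ∩ B, y ∈ connectedComponentIn A x →
      y ∈ connectedComponentIn (A ∩ B) x) :
    ∃ s, IsSection f W (A ∪ B) s ∧ EqOn s sB B ∧
      ∀ x ∈ A, ¬ (connectedComponentIn A x ∩ B).Nonempty → s x = sA x := by
  classical
  have hex : ∀ D : Set ℂ, ∃ s, IsSection f W A s ∧
      ((D ⊆ A ∧ (D ∩ B).Nonempty) → ∃ X ∈ D ∩ B, s X = sB X) ∧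
      (¬ (D ∩ B).Nonempty → s = sA) := by
    intro D
    by_cases hD : D ⊆ A ∧ (D ∩ B).Nonempty
    · obtain ⟨hDA, X, hX⟩ := hD
      obtain ⟨s, hs, hsq⟩ := hA (sB X) (hsB.mapsTo hX.2) (by rw [hsB.apply_eq X hX.2]; exact hDA hX.1)
      rw [hsB.apply_eq X hX.2] at hsq
      exact ⟨s, hs, fun _ => ⟨X, hX, hsq⟩, fun h => absurd ⟨X, hX⟩ h⟩
    · exact ⟨sA, hsA, fun h => absurd h hD, fun _ => rfl⟩
  choose S hS hSB hSA using hex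
  have key : ∀ y ∈ A ∩ B, S (connectedComponentIn A y) y = sB y := by
    intro y hy
    have hyc : y ∈ connectedComponentIn A y := mem_connectedComponentIn hy.1
    obtain ⟨X, hX, hXs⟩ := hSB (connectedComponentIn A y)
      ⟨connectedComponentIn_subset _ _, y, hyc, hy.2⟩
    have hXA : X ∈ A := connectedComponentIn_subset _ _ hX.1
    have hy' : y ∈ connectedComponentIn (A ∩ B) X := by
      refine H X ⟨hXA, hX.2⟩ y hy ?_
      rwa [← connectedComponentIn_eq hX.1]
    have hsub := connectedComponentIn_subset (A ∩ B) X
    exact hf.eqOn_sections (hS _) hsB isPreconnected_connectedComponentIn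
      (hsub.trans inter_subset_left) (hsub.trans inter_subset_right)
      (mem_connectedComponentIn ⟨hXA, hX.2⟩) hXs hy'
  let s : ℂ → ℂ := fun y => if y ∈ B then sB y else S (connectedComponentIn A y) y
  have hsB' : EqOn s sB B := fun y hy => if_pos hy
  have hsA' : ∀ y ∈ A, s y = S (connectedComponentIn A y) y := by
    intro y hy
    by_cases hyB : y ∈ B
    · rw [hsB' hyB, key y ⟨hy, hyB⟩]
    · exact if_neg hyB
  refine ⟨s, ⟨?_, ?_, ?_⟩, hsB', ?_⟩
  · intro x hx
    apply ContinuousAt.continuousWithinAt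
    rcases hx with hx | hx
    · have hn : connectedComponentIn A x ∈ 𝓝 x :=
        hAo.connectedComponentIn.mem_nhds (mem_connectedComponentIn hx)
      refine (((hS (connectedComponentIn A x)).cont x hx).continuousAt (hAo.mem_nhds hx)).congr ?_
      filter_upwards [hn] with y hy
      rw [hsA' y (connectedComponentIn_subset _ _ hy), connectedComponentIn_eq hy]
    · refine ((hsB.cont x hx).continuousAt (hBo.mem_nhds hx)).congr ?_
      filter_upwards [hBo.mem_nhds hx] with y hy
      exact (hsB' hy).symm
  · rintro x (hx | hx)
    · rw [hsA' x hx]; exact (hS _).mapsTo hx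
    · rw [hsB' hx]; exact hsB.mapsTo hx
  · rintro x (hx | hx)
    · rw [hsA' x hx]; exact (hS _).apply_eq x hx
    · rw [hsB' hx]; exact hsB.apply_eq x hx
  · intro x hx hn
    rw [hsA' x hx, hSA _ hn]

theorem HasSections.union {f : ℂ → ℂ} {W A B : Set ℂ} (hf : LocInjOn f W) (hAo : IsOpen A)
    (hBo : IsOpen B) (hA : HasSections f W A) (hB : HasSections f W B)
    (hAs : A ⊆ f '' W) (hBs : B ⊆ f '' W)
    (H : ∀ x ∈ A ∩ B, ∀ y ∈ A ∩ B, y ∈ connectedComponentIn A x →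
      y ∈ connectedComponentIn (A ∩ B) x) :
    HasSections f W (A ∪ B) := by
  have exA : ∃ s, IsSection f W A s := by
    rcases A.eq_empty_or_nonempty with rfl | ⟨x, hx⟩
    · exact ⟨id, continuousOn_empty _, mapsTo_empty _ _, fun x hx => hx.elim⟩
    · obtain ⟨q, hq, rfl⟩ := hAs hx
      exact (hA q hq hx).imp fun s h => h.1
  have exB : ∃ s, IsSection f W B s := by
    rcases B.eq_empty_or_nonempty with rfl | ⟨x, hx⟩
    · exact ⟨id, continuousOn_empty _, mapsTo_empty _ _, fun x hx => hx.elim⟩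
    · obtain ⟨q, hq, rfl⟩ := hBs hx
      exact (hB q hq hx).imp fun s h => h.1
  rintro q hq (hqA | hqB)
  · obtain ⟨sA, hsA, hsq⟩ := hA q hq hqA
    by_cases hn : (connectedComponentIn A (f q) ∩ B).Nonempty
    · obtain ⟨x, hx, hxB⟩ := hn
      have hxA : x ∈ A := connectedComponentIn_subset _ _ hx
      obtain ⟨sB, hsB, hsx⟩ := hB (sA x) (hsA.mapsTo hxA) (by rwa [hsA.apply_eq x hxA])
      rw [hsA.apply_eq x hxA] at hsx
      obtain ⟨s, hs, hsB', -⟩ := HasSections.glue hf hAo hBo hA hsA hsB H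
      refine ⟨s, hs, ?_⟩
      have := hf.eqOn_sections hs hsA (isPreconnected_connectedComponentIn (F := A) (x := f q))
        ((connectedComponentIn_subset _ _).trans subset_union_left)
        (connectedComponentIn_subset _ _) hx (by rw [hsB' hxB, hsx])
      rw [this (mem_connectedComponentIn hqA), hsq]
    · obtain ⟨sB, hsB⟩ := exB
      obtain ⟨s, hs, -, h⟩ := HasSections.glue hf hAo hBo hA hsA hsB H
      exact ⟨s, hs, by rw [h _ hqA hn, hsq]⟩
  · obtain ⟨sB, hsB, hsq⟩ := hB q hq hqB
    obtain ⟨sA, hsA⟩ := exA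
    obtain ⟨s, hs, h, -⟩ := HasSections.glue hf hAo hBo hA hsA hsB H
    exact ⟨s, hs, by rw [h hqB, hsq]⟩

/-! ### Winding around a missing point. -/

/-- If the quotient were a real `r ≤ 0`, then `z` would be the convex combination of `a` and `b`
with weights `1 / (1 - r)` and `-r / (1 - r)`. -/
theorem div_sub_mem_slitPlane_of_notMem_segment {a b z : ℂ} (hz : z ∉ segment ℝ a b) :
    (z - a) / (z - b) ∈ slitPlane := by
  have hzb : z - b ≠ 0 := fun h => hz (by rw [sub_eq_zero.1 h]; exact right_mem_segment ℝ a b)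
  by_contra hcon
  rw [mem_slitPlane_iff, not_or, not_lt, not_not] at hcon
  set w := (z - a) / (z - b) with hw
  have hwr : w = (w.re : ℂ) := by apply Complex.ext <;> simp [hcon.2]
  have h1 : z - a = w.re * (z - b) := by rw [← hwr, hw, div_mul_cancel₀ _ hzb]
  have hpos : 0 < 1 - w.re := by linarith [hcon.1]
  refine hz ⟨1 / (1 - w.re), -w.re / (1 - w.re), by positivity,
    div_nonneg (by linarith [hcon.1]) hpos.le, by field_simp; ring, ?_⟩
  have hne : (1 - w.re : ℂ) ≠ 0 := by exact_mod_cast hpos.ne'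
  simp only [real_smul]
  push_cast
  field_simp
  linear_combination -h1

theorem exists_log_of_segment {A : Set ℂ} {p c : ℂ} (hseg : Disjoint (segment ℝ p c) A)
    {l : ℂ → ℂ} (hl : ContinuousOn l A) (he : ∀ z ∈ A, exp (l z) = z - p) :
    ∃ m : ℂ → ℂ, ContinuousOn m A ∧ ∀ z ∈ A, exp (m z) = z - c := by
  have hp : ∀ z ∈ A, z - p ≠ 0 := fun z hz h =>
    disjoint_left.1 hseg (left_mem_segment ℝ p c) (by rwa [← sub_eq_zero.1 h])
  have hsl : ∀ z ∈ A, (z - c) / (z - p) ∈ slitPlane := fun z hz =>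
    div_sub_mem_slitPlane_of_notMem_segment fun h =>
      disjoint_left.1 hseg (segment_symm ℝ c p ▸ h) hz
  refine ⟨fun z => l z + log ((z - c) / (z - p)), hl.add (ContinuousOn.clog ?_ hsl), ?_⟩
  · exact ContinuousOn.div (by fun_prop) (by fun_prop) hp
  · intro z hz
    rw [exp_add, he z hz, exp_log (slitPlane_ne_zero (hsl z hz)), mul_div_cancel₀ _ (hp z hz)]

/-- If `z - c` has a logarithm on `A ∪ B`, where `A` misses the upward ray from `c` and `B` lies
above `c`, then points of `B` on the two sides of the ray are not connected in `A`. -/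
theorem false_of_connected_around_ray {T B : Set ℂ} {c : ℂ} {l : ℂ → ℂ} (hT : IsPreconnected T)
    (hB : IsPreconnected B) (hray : ∀ z ∈ T, z.re = c.re → z.im < c.im)
    (hBc : ∀ z ∈ B, c.im < z.im) (hl : ContinuousOn l (T ∪ B))
    (he : ∀ z ∈ T ∪ B, exp (l z) = z - c) {x y : ℂ} (hx : x ∈ T ∩ B) (hy : y ∈ T ∩ B)
    (hxc : x.re < c.re) (hyc : c.re < y.re) : False := by
  -- Multiplication by `I` turns the upward ray from `c` into the negative real axis, so `log (I *
  -- (z - c)) - log I` is a branch of `log (z - c)` on `T`. On `B` the principal branch itself is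
  -- continuous.
  have hslT : ∀ z ∈ T, I * (z - c) ∈ slitPlane := by
    intro z hz
    rw [mem_slitPlane_iff]
    by_cases h : z.re = c.re
    · left
      have := hray z hz h
      simp
      linarith
    · right
      simpa [sub_eq_zero] using h
  have hslB : ∀ z ∈ B, z - c ∈ slitPlane := by
    intro z hz
    rw [mem_slitPlane_iff]
    right
    have := hBc z hz
    simp
    intro h
    linarith
  have e1 := sub_eq_sub_of_exp_eq hT (hl.mono subset_union_left)
    (v := fun z => log (I * (z - c)) - log I)
    ((ContinuousOn.clog (by fun_prop) hslT).sub continuousOn_const)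
    (fun z hz => by
      rw [he z (Or.inl hz), exp_sub, exp_log (slitPlane_ne_zero (hslT z hz)), exp_log I_ne_zero,
        mul_div_cancel_left₀ _ I_ne_zero]) hx.1 hy.1
  have e2 := sub_eq_sub_of_exp_eq hB (hl.mono subset_union_right)
    (v := fun z => log (z - c)) (ContinuousOn.clog (by fun_prop) hslB)
    (fun z hz => by
      rw [he z (Or.inr hz), exp_log (slitPlane_ne_zero (hslB z hz))]) hx.2 hy.2
  -- The two branches agree at `y`, right of the ray. Both differ from `l` by constants, so they
  -- would also agree at `x`; but there `arg (x - c) > π / 2`, and adding `arg I` exceeds `π`.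
  have e3 : log (I * (y - c)) = log I + log (y - c) := by
    rw [log_mul_eq_add_log_iff I_ne_zero (slitPlane_ne_zero (hslB y hy.2)), arg_I]
    have h1 : |arg (y - c)| < Real.pi / 2 := by
      rw [abs_arg_lt_pi_div_two_iff]
      left; simpa using hyc
    have := abs_lt.1 h1
    constructor <;> linarith [Real.pi_pos]
  have e4 : log (I * (x - c)) = log I + log (x - c) := by
    linear_combination e2 - e1 + e3
  rw [log_mul_eq_add_log_iff I_ne_zero (slitPlane_ne_zero (hslB x hx.2)), arg_I] at e4
  have h2 : arg (x - c) ≤ Real.pi / 2 := by linarith [e4.2]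
  rw [arg_le_pi_div_two_iff] at h2
  have := hBc x hx.2
  simp only [sub_re, sub_im] at h2
  rcases h2 with h | h <;> linarith

/-! ### Building sections over a union of grid squares. -/

/-- The open square of half-width `1` around the lattice point `i + j I`. -/
def box (j i : ℤ) : Set ℂ := Ioo (i - 1 : ℝ) (i + 1) ×ℂ Ioo (j - 1 : ℝ) (j + 1)

/-- The closed square of half-width `1` around the lattice point `i + j I`. -/
def closedBox (j i : ℤ) : Set ℂ := Icc (i - 1 : ℝ) (i + 1) ×ℂ Icc (j - 1 : ℝ) (j + 1)

theorem isOpen_box (j i : ℤ) : IsOpen (box j i) := isOpen_Ioo.reProdIm isOpen_Ioo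
theorem convex_box (j i : ℤ) : Convex ℝ (box j i) := 
  ((convex_Ioo _ _).is_linear_preimage reLm.isLinear).inter
    ((convex_Ioo _ _).is_linear_preimage imLm.isLinear)
theorem isCompact_closedBox (j i : ℤ) : IsCompact (closedBox j i) :=
  isCompact_Icc.reProdIm isCompact_Icc
theorem box_subset_closedBox (j i : ℤ) : box j i ⊆ closedBox j i := fun _ hz =>
  ⟨Ioo_subset_Icc_self hz.1, Ioo_subset_Icc_self hz.2⟩

theorem mem_box {j i : ℤ} {z : ℂ} :
    z ∈ box j i ↔ ((i : ℝ) - 1 < z.re ∧ z.re < i + 1) ∧ ((j : ℝ) - 1 < z.im ∧ z.im < j + 1) :=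
  Iff.rfl

theorem mem_closedBox {j i : ℤ} {z : ℂ} :
    z ∈ closedBox j i ↔
      ((i : ℝ) - 1 ≤ z.re ∧ z.re ≤ i + 1) ∧ ((j : ℝ) - 1 ≤ z.im ∧ z.im ≤ j + 1) :=
  Iff.rfl

/-- If `q` is beyond one end of `[m - 1, m + 1]`, then the integer `n`, being within `1` of `q`, is
at or beyond that same end; so is every point between them. -/
theorem add_mul_sub_notMem_Ioo {n m : ℤ} {q t : ℝ} (h1 : (n : ℝ) - 1 ≤ q) (h2 : q ≤ n + 1)
    (hq : ¬ ((m : ℝ) - 1 ≤ q ∧ q ≤ m + 1)) (ht0 : 0 ≤ t) (ht1 : t ≤ 1) :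
    ¬ ((m : ℝ) - 1 < n + t * (q - n) ∧ n + t * (q - n) < m + 1) := by
  rintro ⟨h3, h4⟩
  rw [not_and_or, not_le, not_le] at hq
  rcases hq with hq | hq
  · have : n < m := by
      have : (n : ℝ) < m := by linarith
      exact_mod_cast this
    have : (n : ℝ) + 1 ≤ m := by exact_mod_cast this
    nlinarith
  · have : m < n := by
      have : (m : ℝ) < n := by linarith
      exact_mod_cast this
    have : (m : ℝ) + 1 ≤ n := by exact_mod_cast this
    nlinarith

theorem disjoint_segment_box {j i j' i' : ℤ} {p : ℂ} (hp : p ∈ closedBox j i)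
    (hp' : p ∉ closedBox j' i') : Disjoint (segment ℝ p ⟨i, j⟩) (box j' i') := by
  rw [disjoint_left]
  rintro z ⟨a, b, ha, hb, hab, rfl⟩ hz
  have hb' : b = 1 - a := by linarith
  subst hb'
  rw [mem_box] at hz
  rw [mem_closedBox] at hp hp'
  have hre : (a • p + (1 - a) • (⟨i, j⟩ : ℂ)).re = i + a * (p.re - i) := by
    simp; ring
  have him : (a • p + (1 - a) • (⟨i, j⟩ : ℂ)).im = j + a * (p.im - j) := by
    simp; ring
  rw [hre, him] at hz
  rcases not_and_or.1 hp' with h | h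
  · exact add_mul_sub_notMem_Ioo hp.1.1 hp.1.2 h ha (by linarith) hz.1
  · exact add_mul_sub_notMem_Ioo hp.2.1 hp.2.2 h ha (by linarith) hz.2

theorem box_neighbour {j i j' i' : ℤ} (hlt : j' < j ∨ j' = j ∧ i' < i) {x : ℂ}
    (hx : x ∈ box j i) (hx' : x ∈ box j' i') :
    (j' = j ∧ i' = i - 1) ∨ (j' = j - 1 ∧ (i' = i - 1 ∨ i' = i ∨ i' = i + 1)) := by
  rw [mem_box] at hx hx'
  have h1 : j < j' + 2 := by
    have : (j : ℝ) < j' + 2 := by linarith [hx.2.1, hx'.2.2]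
    exact_mod_cast this
  have h2 : i < i' + 2 := by
    have : (i : ℝ) < i' + 2 := by linarith [hx.1.1, hx'.1.2]
    exact_mod_cast this
  have h3 : i' < i + 2 := by
    have : (i' : ℝ) < i + 2 := by linarith [hx'.1.1, hx.1.2]
    exact_mod_cast this
  omega

/-- The union of a set of boxes. -/
def cells (S : Finset (ℤ ×ₗ ℤ)) : Set ℂ := {z | ∃ j i : ℤ, toLex (j, i) ∈ S ∧ z ∈ box j i}

theorem isOpen_cells (S : Finset (ℤ ×ₗ ℤ)) : IsOpen (cells S) := by
  rw [isOpen_iff_mem_nhds]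
  rintro z ⟨j, i, h, hz⟩
  filter_upwards [(isOpen_box j i).mem_nhds hz] with y hy
  exact ⟨j, i, h, hy⟩

/-- A rejected square contains some `p` outside `Ω`, and fullness gives a logarithm of `z - p`. The
segment from `p` to the centre of the square avoids the accepted open squares, so the pole can be
moved to the centre. -/
theorem exists_log_cells {Ω : Set ℂ} (hΩ : IsFull Ω) {S : Finset (ℤ ×ₗ ℤ)}
    (hS : ∀ j i, toLex (j, i) ∈ S → closedBox j i ⊆ Ω) {j i : ℤ} (hji : ¬ closedBox j i ⊆ Ω) :
    ∃ l : ℂ → ℂ, ContinuousOn l (cells S) ∧ ∀ z ∈ cells S, exp (l z) = z - ⟨i, j⟩ := by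
  obtain ⟨p, hp, hpΩ⟩ := not_subset.1 hji
  let K : Set ℂ := ⋃ c ∈ S, closedBox (ofLex c).1 (ofLex c).2
  have hK : IsCompact K := S.isCompact_biUnion fun c _ => isCompact_closedBox _ _
  have hKΩ : K ⊆ Ω := iUnion₂_subset fun c hc => hS _ _ hc
  have hSK : cells S ⊆ K := by
    rintro z ⟨j', i', h, hz⟩
    exact mem_iUnion₂.2 ⟨_, h, box_subset_closedBox _ _ hz⟩
  obtain ⟨l, hl, he⟩ := hΩ.exists_log hK hKΩ hpΩ
  refine exists_log_of_segment ?_ (hl.mono hSK) fun z hz => he z (hSK hz)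
  rw [disjoint_right]
  rintro z ⟨j', i', h, hz⟩
  exact disjoint_right.1 (disjoint_segment_box hp fun h' => hpΩ (hS _ _ h h')) hz

theorem mem_connectedComponentIn_of_convex {A P : Set ℂ} (hP : Convex ℝ P) (hPA : P ⊆ A)
    {x y : ℂ} (hx : x ∈ P) (hy : y ∈ P) : y ∈ connectedComponentIn A x :=
  hP.isPreconnected.subset_connectedComponentIn hx hPA hy

theorem mem_connectedComponentIn_symm {A : Set ℂ} {x y : ℂ} (h : y ∈ connectedComponentIn A x) :
    x ∈ connectedComponentIn A y := by
  rw [← connectedComponentIn_eq h]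
  by_contra hx
  have : x ∉ A := fun h => hx (mem_connectedComponentIn h)
  rw [connectedComponentIn_eq_empty this] at h
  exact h

theorem mem_connectedComponentIn_trans {A : Set ℂ} {x y z : ℂ}
    (h : y ∈ connectedComponentIn A x) (h' : z ∈ connectedComponentIn A y) :
    z ∈ connectedComponentIn A x := by
  rwa [connectedComponentIn_eq h]

/-- Of the squares preceding `(j, i)`, only the left one and three in the row below meet it. Their
overlaps can be disconnected only when the square directly below is absent and there are squares on
both of its sides. By `hgap` that square then contains a point outside `Ω`, and a connection through
`cells s` together with the new box would encircle its centre. -/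
theorem cells_inter_box_components {Ω : Set ℂ} (hΩ : IsFull Ω) {s : Finset (ℤ ×ₗ ℤ)} {j i : ℤ}
    (hlt : ∀ j' i', toLex (j', i') ∈ s → j' < j ∨ j' = j ∧ i' < i)
    (hs : ∀ j' i', toLex (j', i') ∈ s → closedBox j' i' ⊆ Ω) (hji : closedBox j i ⊆ Ω)
    (hgap : toLex (j - 1, i) ∉ s → toLex (j - 1, i + 1) ∈ s →
      (toLex (j - 1, i - 1) ∈ s ∨ toLex (j, i - 1) ∈ s) → ¬ closedBox (j - 1) i ⊆ Ω) :
    ∀ x ∈ cells s ∩ box j i, ∀ y ∈ cells s ∩ box j i, y ∈ connectedComponentIn (cells s) x →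
      y ∈ connectedComponentIn (cells s ∩ box j i) x := by
  classical
  set A := cells s
  set B := box j i
  -- Lower left and lower right marker points of the new box: every overlap with an earlier square
  -- contains one of them, and the square directly below contains both.
  let L : ℂ := ⟨i - 1 / 2, j - 1 / 2⟩
  let R : ℂ := ⟨i + 1 / 2, j - 1 / 2⟩
  have hLB : L ∈ B := by rw [mem_box]; simp only [L]; refine ⟨⟨?_, ?_⟩, ?_, ?_⟩ <;> linarith
  have hRB : R ∈ B := by rw [mem_box]; simp only [R]; refine ⟨⟨?_, ?_⟩, ?_, ?_⟩ <;> linarith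
  have conv : ∀ {j' i' : ℤ} {u v : ℂ}, toLex (j', i') ∈ s → u ∈ box j' i' → v ∈ box j' i' →
      u ∈ B → v ∈ B → v ∈ connectedComponentIn (A ∩ B) u := by
    intro j' i' u v h hu hv huB hvB
    refine mem_connectedComponentIn_of_convex (P := box j' i' ∩ B)
      ((convex_box _ _).inter (convex_box _ _)) ?_ ⟨hu, huB⟩ ⟨hv, hvB⟩
    exact inter_subset_inter_left _ fun z hz => ⟨j', i', h, hz⟩
  have hLbox : ∀ {j' i' : ℤ}, (j' = j ∧ i' = i - 1) ∨ (j' = j - 1 ∧ (i' = i - 1 ∨ i' = i)) →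
      L ∈ box j' i' := by
    rintro j' i' (⟨rfl, rfl⟩ | ⟨rfl, rfl | rfl⟩) <;> rw [mem_box] <;> simp only [L] <;>
      push_cast <;> refine ⟨⟨?_, ?_⟩, ?_, ?_⟩ <;> linarith
  have hRbox : ∀ {j' i' : ℤ}, (j' = j - 1 ∧ (i' = i ∨ i' = i + 1)) → R ∈ box j' i' := by
    rintro j' i' ⟨rfl, rfl | rfl⟩ <;> rw [mem_box] <;> simp only [R] <;>
      push_cast <;> refine ⟨⟨?_, ?_⟩, ?_, ?_⟩ <;> linarith
  have side : ∀ x ∈ A ∩ B,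
      (L ∈ connectedComponentIn (A ∩ B) x ∧
        (toLex (j - 1, i) ∉ s → (toLex (j - 1, i - 1) ∈ s ∨ toLex (j, i - 1) ∈ s))) ∨
      (R ∈ connectedComponentIn (A ∩ B) x ∧
        (toLex (j - 1, i) ∉ s → toLex (j - 1, i + 1) ∈ s)) := by
    rintro x ⟨⟨j', i', h, hx⟩, hxB⟩
    rcases box_neighbour (hlt j' i' h) hxB hx with ⟨rfl, rfl⟩ | ⟨rfl, rfl | rfl | rfl⟩
    · exact Or.inl ⟨conv h hx (hLbox (Or.inl ⟨rfl, rfl⟩)) hxB hLB, fun _ => Or.inr h⟩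
    · exact Or.inl ⟨conv h hx (hLbox (Or.inr ⟨rfl, Or.inl rfl⟩)) hxB hLB, fun _ => Or.inl h⟩
    · exact Or.inl ⟨conv h hx (hLbox (Or.inr ⟨rfl, Or.inr rfl⟩)) hxB hLB, fun h' => absurd h h'⟩
    · exact Or.inr ⟨conv h hx (hRbox ⟨rfl, Or.inr rfl⟩) hxB hRB, fun _ => h⟩
  have mono : ∀ {u v : ℂ}, v ∈ connectedComponentIn (A ∩ B) u → v ∈ connectedComponentIn A u :=
    fun h => connectedComponentIn_mono _ inter_subset_left h
  have cross : ∀ x ∈ A ∩ B, ∀ y ∈ A ∩ B, y ∈ connectedComponentIn A x →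
      L ∈ connectedComponentIn (A ∩ B) x → R ∈ connectedComponentIn (A ∩ B) y →
      (toLex (j - 1, i) ∉ s → (toLex (j - 1, i - 1) ∈ s ∨ toLex (j, i - 1) ∈ s)) →
      (toLex (j - 1, i) ∉ s → toLex (j - 1, i + 1) ∈ s) →
      y ∈ connectedComponentIn (A ∩ B) x := by
    intro x hx y hy hxy hxL hyR h1 h2
    by_cases hD : toLex (j - 1, i) ∈ s
    · have hLR : R ∈ connectedComponentIn (A ∩ B) L :=
        conv hD (hLbox (Or.inr ⟨rfl, Or.inr rfl⟩)) (hRbox ⟨rfl, Or.inl rfl⟩) hLB hRB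
      exact mem_connectedComponentIn_trans (mem_connectedComponentIn_trans hxL hLR)
        (mem_connectedComponentIn_symm hyR)
    · exfalso
      have hn := hgap hD (h2 hD) (h1 hD)
      obtain ⟨l, hl, he⟩ := exists_log_cells hΩ (S := insert (toLex (j, i)) s)
        (fun j' i' h => by
          rcases Finset.mem_insert.1 h with h | h
          · obtain ⟨rfl, rfl⟩ : j' = j ∧ i' = i := by simpa using h
            exact hji
          · exact hs _ _ h) hn
      have hsub : connectedComponentIn A x ∪ B ⊆ cells (insert (toLex (j, i)) s) := by
        rintro z (hz | hz)
        · obtain ⟨j', i', h, hz⟩ := connectedComponentIn_subset _ _ hz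
          exact ⟨j', i', Finset.mem_insert_of_mem h, hz⟩
        · exact ⟨j, i, Finset.mem_insert_self _ _, hz⟩
      refine false_of_connected_around_ray (isPreconnected_connectedComponentIn (F := A) (x := x))
        (convex_box j i).isPreconnected ?_ ?_ (hl.mono hsub) (fun z hz => he z (hsub hz))
        ⟨mono hxL, hLB⟩ ⟨mem_connectedComponentIn_trans hxy (mono hyR), hRB⟩ ?_ ?_
      · intro z hz hzre
        obtain ⟨j', i', h, hz⟩ := connectedComponentIn_subset _ _ hz
        rw [mem_box] at hz
        by_contra hzim
        simp only [not_lt] at hzre hzim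
        push_cast at hzim
        have h3 : i' = i := by
          have h4 : i < i' + 1 := by
            have : (i : ℝ) < i' + 1 := by linarith [hz.1.2]
            exact_mod_cast this
          have h5 : i' < i + 1 := by
            have : (i' : ℝ) < i + 1 := by linarith [hz.1.1]
            exact_mod_cast this
          omega
        have h6 : j < j' + 2 := by
          have : (j : ℝ) < j' + 2 := by linarith [hz.2.2]
          exact_mod_cast this
        have h7 := hlt j' i' h
        have h8 : j' = j - 1 := by omega
        subst h3 h8
        exact hD h
      · intro z hz
        rw [mem_box] at hz
        push_cast
        exact hz.2.1
      · simp only [L]; linarith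
      · simp only [R]; linarith
  intro x hx y hy hxy
  rcases side x hx with ⟨hxL, h1⟩ | ⟨hxR, h1⟩ <;> rcases side y hy with ⟨hyL, h2⟩ | ⟨hyR, h2⟩
  · exact mem_connectedComponentIn_trans hxL (mem_connectedComponentIn_symm hyL)
  · exact cross x hx y hy hxy hxL hyR h1 h2
  · exact mem_connectedComponentIn_symm
      (cross y hy x hx (mem_connectedComponentIn_symm hxy) hyL hxR h2 h1)
  · exact mem_connectedComponentIn_trans hxR (mem_connectedComponentIn_symm hyR)

theorem cells_insert (a : ℤ ×ₗ ℤ) (s : Finset (ℤ ×ₗ ℤ)) :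
    cells (insert a s) = cells s ∪ box (ofLex a).1 (ofLex a).2 := by
  ext z
  constructor
  · rintro ⟨j, i, h, hz⟩
    rcases Finset.mem_insert.1 h with rfl | h
    · exact Or.inr hz
    · exact Or.inl ⟨j, i, h, hz⟩
  · rintro (⟨j, i, h, hz⟩ | hz)
    · exact ⟨j, i, Finset.mem_insert_of_mem h, hz⟩
    · exact ⟨_, _, Finset.mem_insert_self _ _, hz⟩

/-- Squares are added in lexicographic order, row by row from below, so that
`cells_inter_box_components` supplies the overlap condition of `HasSections.union` at each stage. -/
theorem hasSections_cells {f : ℂ → ℂ} {W Ω : Set ℂ} (hf : LocInjOn f W) (hΩ : IsFull Ω)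
    (hsurj : Ω ⊆ f '' W) {S : Finset (ℤ ×ₗ ℤ)}
    (hS : ∀ j i, toLex (j, i) ∈ S → closedBox j i ⊆ Ω)
    (hgap : ∀ j i, toLex (j, i) ∉ S → toLex (j, i + 1) ∈ S →
      (toLex (j, i - 1) ∈ S ∨ toLex (j + 1, i - 1) ∈ S) → ¬ closedBox j i ⊆ Ω)
    (hbox : ∀ j i, toLex (j, i) ∈ S → HasSections f W (box j i)) :
    HasSections f W (cells S) := by
  have key : ∀ T : Finset (ℤ ×ₗ ℤ), T ⊆ S → (∀ x ∈ T, ∀ y ∈ S, y < x → y ∈ T) →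
      HasSections f W (cells T) := by
    intro T
    induction T using Finset.induction_on_max with
    | empty =>
      rintro - - q - ⟨j, i, h, -⟩
      simp at h
    | insert a s hmax ih =>
      intro hsub hlow
      have hsS : s ⊆ S := fun x hx => hsub (Finset.mem_insert_of_mem hx)
      have haS : a ∈ S := hsub (Finset.mem_insert_self _ _)
      have hlow' : ∀ y ∈ S, y < a → y ∈ s := fun y hy hya =>
        (Finset.mem_insert.1 (hlow a (Finset.mem_insert_self _ _) y hy hya)).resolve_left hya.ne
      have ih' := ih hsS fun x hx y hy hyx => hlow' y hy (hyx.trans (hmax x hx))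
      obtain ⟨j, i, rfl⟩ : ∃ j i, a = toLex (j, i) := ⟨_, _, rfl⟩
      have hD : ∀ i', toLex (j - 1, i') < toLex (j, i) := fun i' => by
        rw [Prod.Lex.toLex_lt_toLex]; left; simp
      rw [cells_insert]
      refine HasSections.union hf (isOpen_cells _) (isOpen_box _ _) ih' (hbox j i haS) ?_ ?_ ?_
      · rintro z ⟨j', i', h, hz⟩
        exact hsurj (hS _ _ (hsS h) (box_subset_closedBox _ _ hz))
      · exact (box_subset_closedBox _ _).trans ((hS _ _ haS).trans hsurj)
      · refine cells_inter_box_components hΩ ?_ (fun j' i' h => hS _ _ (hsS h)) (hS _ _ haS) ?_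
        · intro j' i' h
          simpa [Prod.Lex.toLex_lt_toLex] using hmax _ h
        · intro h1 h2 h3
          refine hgap (j - 1) i (fun h => h1 (hlow' _ h (hD i))) (hsS h2) ?_
          rw [sub_add_cancel]
          exact h3.imp (fun h => hsS h) (fun h => hsS h)
  exact key S subset_rfl fun _ _ y hy _ => hy

/-! ### Proper unbranched maps are coverings, and injective over full targets. -/

theorem isLocalHomeomorphOn_of_hasStrictDerivAt {f : ℂ → ℂ} {W : Set ℂ}
    (hd : ∀ x ∈ W, ∃ f' ≠ 0, HasStrictDerivAt f f' x) : IsLocalHomeomorphOn f W := by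
  intro x hx
  obtain ⟨f', h0, h⟩ := hd x hx
  exact ⟨(h.hasStrictFDerivAt_equiv h0).toOpenPartialHomeomorph f,
    (h.hasStrictFDerivAt_equiv h0).mem_toOpenPartialHomeomorph_source, rfl⟩

theorem isLocalHomeomorph_restrict {f : ℂ → ℂ} {W Ω : Set ℂ} (hW : IsOpen W) (hΩ : IsOpen Ω)
    (h : MapsTo f W Ω) (hd : ∀ x ∈ W, ∃ f' ≠ 0, HasStrictDerivAt f f' x) :
    IsLocalHomeomorph (h.restrict f W Ω) := by
  have h1 := isLocalHomeomorphOn_of_hasStrictDerivAt hd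
  have h2 : IsLocalHomeomorph (fun x : W => f x) := by
    rw [isLocalHomeomorph_iff_isLocalHomeomorphOn_univ]
    exact h1.comp (hW.isOpenEmbedding_subtypeVal.isLocalHomeomorph.isLocalHomeomorphOn)
      (fun x _ => x.2)
  refine IsLocalHomeomorph.of_comp (g := Subtype.val) (f := h.restrict f W Ω) h2
    hΩ.isOpenEmbedding_subtypeVal.isLocalHomeomorph ?_
  exact h1.continuousOn.mapsToRestrict h

theorem isProperMap_restrict {f : ℂ → ℂ} {W Ω : Set ℂ} (h : MapsTo f W Ω) (hΩ : IsOpen Ω)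
    (hc : ContinuousOn f W) (hp : ∀ C ⊆ Ω, IsCompact C → IsCompact (W ∩ f ⁻¹' C)) :
    IsProperMap (h.restrict f W Ω) := by
  have : LocallyCompactSpace Ω := hΩ.locallyCompactSpace
  rw [isProperMap_iff_isCompact_preimage]
  refine ⟨hc.mapsToRestrict h, fun K hK => ?_⟩
  rw [Subtype.isCompact_iff]
  convert hp (Subtype.val '' K) (by simp) (hK.image continuous_subtype_val) using 1
  ext z
  simp only [mem_image, mem_preimage, Subtype.exists, exists_and_right, exists_eq_right, mem_inter_iff]
  constructor
  · rintro ⟨hz, hk⟩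
    exact ⟨hz, h hz, hk⟩
  · rintro ⟨hz, _, hk⟩
    exact ⟨hz, hk⟩

/-- A proper local homeomorphism has compact discrete, hence finite, fibres, and being closed it
evenly covers a neighbourhood of each point. -/
theorem isCoveringMap_restrict {f : ℂ → ℂ} {W Ω : Set ℂ} (hW : IsOpen W) (hΩ : IsOpen Ω)
    (h : MapsTo f W Ω) (hd : ∀ x ∈ W, ∃ f' ≠ 0, HasStrictDerivAt f f' x)
    (hp : ∀ C ⊆ Ω, IsCompact C → IsCompact (W ∩ f ⁻¹' C)) :
    IsCoveringMap (h.restrict f W Ω) := by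
  have hl := isLocalHomeomorph_restrict hW hΩ h hd
  have hprop := isProperMap_restrict h hΩ
    (isLocalHomeomorphOn_of_hasStrictDerivAt hd).continuousOn hp
  rw [isCoveringMap_iff_isCoveringMapOn_univ]
  refine hprop.isClosedMap.isCoveringMapOn_of_isLocalHomeomorphOn ?_ ?_
  · intro x _
    refine (hprop.isCompact_preimage isCompact_singleton).finite ?_
    exact IsDiscrete.of_openPartialHomeomorph (h.restrict f W Ω) subset_rfl
      fun e _ => (hl e).imp fun φ hφ => ⟨hφ.1, hφ.2.symm⟩
  · exact hl.isLocalHomeomorphOn.mono (subset_univ _)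

theorem surjOn_of_proper {f : ℂ → ℂ} {W Ω : Set ℂ} (hW : IsOpen W) (hΩ : IsOpen Ω)
    (hΩc : IsPreconnected Ω) (hne : W.Nonempty)
    (h : MapsTo f W Ω) (hd : ∀ x ∈ W, ∃ f' ≠ 0, HasStrictDerivAt f f' x)
    (hp : ∀ C ⊆ Ω, IsCompact C → IsCompact (W ∩ f ⁻¹' C)) : Ω ⊆ f '' W := by
  have hl := isLocalHomeomorph_restrict hW hΩ h hd
  have hprop := isProperMap_restrict h hΩ
    (isLocalHomeomorphOn_of_hasStrictDerivAt hd).continuousOn hp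
  have : PreconnectedSpace Ω := isPreconnected_iff_preconnectedSpace.1 hΩc
  have hr : IsClopen (range (h.restrict f W Ω)) :=
    ⟨hprop.isClosedMap.isClosed_range, hl.isOpenMap.isOpen_range⟩
  obtain ⟨w, hw⟩ := hne
  have := hr.eq_univ ⟨_, mem_range_self (⟨w, hw⟩ : W)⟩
  intro y hy
  obtain ⟨x, hx⟩ := this.ge (mem_univ (⟨y, hy⟩ : Ω))
  exact ⟨x, x.2, congrArg Subtype.val hx⟩

theorem hasSections_of_isCoveringMap {f : ℂ → ℂ} {W Ω A : Set ℂ} (h : MapsTo f W Ω)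
    (cov : IsCoveringMap (h.restrict f W Ω)) (hAΩ : A ⊆ Ω) (hA : IsOpen A) (hAc : Convex ℝ A) :
    HasSections f W A := by
  classical
  intro q hq hqA
  have : ContractibleSpace A := hAc.contractibleSpace ⟨_, hqA⟩
  have : LocallyPathConnectedSpace A := hA.locallyPathConnectedSpace
  obtain ⟨F, ⟨hF1, hF2⟩, -⟩ := cov.existsUnique_continuousMap_lifts
    (⟨inclusion hAΩ, continuous_inclusion hAΩ⟩ : C(A, Ω)) ⟨f q, hqA⟩ ⟨q, hq⟩ rfl
  let s : ℂ → ℂ := fun x => if hx : x ∈ A then F ⟨x, hx⟩ else 0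
  have hs : ∀ x (hx : x ∈ A), s x = F ⟨x, hx⟩ := fun x hx => dif_pos hx
  refine ⟨s, ⟨?_, ?_, ?_⟩, ?_⟩
  · rw [continuousOn_iff_continuous_domRestrict]
    have : A.domRestrict s = fun x => (F x : ℂ) := by
      ext x; exact hs x x.2
    rw [this]
    fun_prop
  · intro x hx
    rw [hs x hx]
    exact (F ⟨x, hx⟩).2
  · intro x hx
    rw [hs x hx]
    exact congrArg Subtype.val (congrFun hF2 ⟨x, hx⟩)
  · rw [hs _ hqA, hF1]

theorem IsFull.scale {Ω : Set ℂ} (hΩ : IsFull Ω) {a : ℂ} (ha : a ≠ 0) :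
    IsFull {z | a⁻¹ * z ∈ Ω} := by
  intro O hO hb hfr
  let e : ℂ ≃ₜ ℂ := Homeomorph.mulLeft₀ a⁻¹ (inv_ne_zero ha)
  have h1 : e '' O ⊆ Ω := by
    refine hΩ _ (e.isOpenMap _ hO) ?_ ?_
    · exact (hb.isCompact_closure.image e.continuous).isBounded.subset
        (image_mono subset_closure)
    · rw [← e.image_frontier]
      rintro _ ⟨x, hx, rfl⟩
      exact hfr hx
  exact fun x hx => h1 ⟨x, hx, rfl⟩

/-- A locally injective map from a planar domain onto a full open set that has sections over convex
open sets is injective. -/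
theorem injOn_of_hasSections {f : ℂ → ℂ} {W Ω : Set ℂ} (hΩ : IsFull Ω) (hΩo : IsOpen Ω)
    (hW : IsOpen W) (hWc : IsPreconnected W) (hfc : ContinuousOn f W) (hf : LocInjOn f W)
    (hmaps : MapsTo f W Ω) (hsurj : Ω ⊆ f '' W)
    (hsec : ∀ A ⊆ Ω, IsOpen A → Convex ℝ A → HasSections f W A) : InjOn f W := by
  classical
  intro p hp p' hp' hpp
  have hpath : IsPathConnected W := hW.isConnected_iff_isPathConnected.1 ⟨⟨p, hp⟩, hWc⟩
  have hj := hpath.joinedIn p hp p' hp'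
  set C := range hj.somePath with hC
  have hCW : C ⊆ W := by rintro _ ⟨t, rfl⟩; exact hj.somePath_mem t
  have hCc : IsCompact C := isCompact_range hj.somePath.continuous
  have hCp : IsPreconnected C := isPreconnected_range hj.somePath.continuous
  have hpC : p ∈ C := ⟨0, hj.somePath.source⟩
  have hpC' : p' ∈ C := ⟨1, hj.somePath.target⟩
  have hfC : IsCompact (f '' C) := hCc.image_of_continuousOn (hfc.mono hCW)
  obtain ⟨δ, hδ, hδΩ⟩ := hfC.exists_cthickening_subset_open hΩo
    (by rintro _ ⟨z, hz, rfl⟩; exact hmaps (hCW hz))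
  -- After scaling by `a`, the closed square about the lattice point nearest to `F z` stays within
  -- distance `4` of `F z`, that is, within `δ` of `f z` before scaling.
  set a : ℝ := 4 / δ with ha
  have ha0 : 0 < a := by positivity
  have haC : (a : ℂ) ≠ 0 := by exact_mod_cast ha0.ne'
  set F : ℂ → ℂ := fun z => a * f z with hF
  set Ω' : Set ℂ := {z | (a : ℂ)⁻¹ * z ∈ Ω} with hΩ'
  have hΩ'f : IsFull Ω' := hΩ.scale haC
  have hFl : LocInjOn F W := fun x hx => by
    obtain ⟨N, hN, hi⟩ := hf x hx
    exact ⟨N, hN, fun u hu v hv huv => hi hu hv (mul_left_cancel₀ haC huv)⟩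
  have hFs : Ω' ⊆ F '' W := by
    intro z hz
    obtain ⟨q, hq, hqz⟩ := hsurj hz
    exact ⟨q, hq, by rw [hF]; simp only; rw [hqz, mul_inv_cancel_left₀ haC]⟩
  obtain ⟨R, hR⟩ := (hfC.image (f := fun z => (a : ℂ) * z) (by fun_prop)).isBounded.exists_norm_le
  -- The window `[-M, M]²` contains the nearest lattice point of every `F z` with `z ∈ C`.
  obtain ⟨M, hM⟩ := exists_int_gt (R + 1)
  let rng : Finset (ℤ × ℤ) := Finset.Icc (-M) M ×ˢ Finset.Icc (-M) M
  let S : Finset (ℤ ×ₗ ℤ) := (rng.filter fun c => closedBox c.1 c.2 ⊆ Ω').map toLex.toEmbedding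
  have hmem : ∀ j i, toLex (j, i) ∈ S ↔
      ((-M ≤ j ∧ j ≤ M) ∧ (-M ≤ i ∧ i ≤ M)) ∧ closedBox j i ⊆ Ω' := by
    intro j i
    simp [S, rng]
  have hall : HasSections F W (cells S) := by
    refine hasSections_cells hFl hΩ'f hFs (fun j i h => ((hmem j i).1 h).2) ?_ ?_
    · intro j i h1 h2 h3 h4
      rw [hmem] at h1 h2 h3
      rw [hmem] at h3
      refine h1 ⟨⟨h2.1.1, ?_⟩, h4⟩
      have := h2.1.2
      rcases h3 with h3 | h3 <;> have := h3.1.2 <;> constructor <;> omega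
    · intro j i h q hq hqb
      have hb := ((hmem j i).1 h).2
      have hpre : {z : ℂ | (a : ℂ) * z ∈ box j i} ⊆ Ω := by
        intro z hz
        have := hb (box_subset_closedBox _ _ hz)
        simpa [hΩ', inv_mul_cancel_left₀ haC] using this
      obtain ⟨s, hs, hsq⟩ := hsec {z : ℂ | (a : ℂ) * z ∈ box j i} hpre
        ((isOpen_box j i).preimage (by fun_prop))
        ((convex_box j i).is_linear_preimage (f := fun z : ℂ => (a : ℂ) * z)
          ((LinearMap.mulLeft ℝ (a : ℂ)).isLinear)) q hq hqb
      have hmap : ∀ x ∈ box j i, (a : ℂ)⁻¹ * x ∈ {z : ℂ | (a : ℂ) * z ∈ box j i} := by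
        intro x hx
        simpa [mul_inv_cancel_left₀ haC] using hx
      refine ⟨fun x => s ((a : ℂ)⁻¹ * x), ⟨?_, ?_, ?_⟩, ?_⟩
      · exact hs.cont.comp (by fun_prop) hmap
      · exact fun x hx => hs.mapsTo (hmap x hx)
      · intro x hx
        simp only [hF]
        rw [hs.apply_eq _ (hmap x hx), mul_inv_cancel_left₀ haC]
      · simp only [hF, inv_mul_cancel_left₀ haC, hsq]
  have hcell : ∀ z ∈ C, F z ∈ cells S := by
    intro z hz
    have hn : ‖F z‖ ≤ R := hR _ ⟨f z, ⟨z, hz, rfl⟩, rfl⟩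
    have hre := (abs_re_le_norm (F z)).trans hn
    have him := (abs_im_le_norm (F z)).trans hn
    rw [abs_le] at hre him
    have r1 := abs_le.1 (abs_sub_round (F z).re)
    have r2 := abs_le.1 (abs_sub_round (F z).im)
    refine ⟨round (F z).im, round (F z).re, (hmem _ _).2 ⟨⟨⟨?_, ?_⟩, ?_, ?_⟩, ?_⟩, ?_⟩
    · have : -(M : ℝ) ≤ round (F z).im := by linarith
      exact_mod_cast this
    · have : (round (F z).im : ℝ) ≤ M := by linarith
      exact_mod_cast this
    · have : -(M : ℝ) ≤ round (F z).re := by linarith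
      exact_mod_cast this
    · have : (round (F z).re : ℝ) ≤ M := by linarith
      exact_mod_cast this
    · intro y hy
      rw [mem_closedBox] at hy
      have h1 : |(y - F z).re| ≤ 2 := by
        rw [sub_re, abs_le]; constructor <;> linarith [hy.1.1, hy.1.2]
      have h2 : |(y - F z).im| ≤ 2 := by
        rw [sub_im, abs_le]; constructor <;> linarith [hy.2.1, hy.2.2]
      have h3 : ‖y - F z‖ ≤ 4 := (norm_le_abs_re_add_abs_im _).trans (by linarith)
      refine hδΩ (mem_cthickening_of_dist_le _ (f z) _ _ ⟨z, hz, rfl⟩ ?_)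
      have h4 : (a : ℂ)⁻¹ * y - f z = (a : ℂ)⁻¹ * (y - F z) := by
        rw [hF, mul_sub, inv_mul_cancel_left₀ haC]
      rw [dist_eq_norm, h4, norm_mul, norm_inv, norm_real, Real.norm_of_nonneg ha0.le,
        inv_mul_le_iff₀ ha0, ha, div_mul_cancel₀ _ hδ.ne']
      exact h3
    · rw [mem_box]
      refine ⟨⟨?_, ?_⟩, ?_, ?_⟩ <;> linarith
  obtain ⟨s, hs, hsp⟩ := hall p hp (hcell p hpC)
  have hFc : ContinuousOn F C := (continuousOn_const.mul (hfc.mono hCW))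
  -- Along the path, `s ∘ F` and the identity are lifts of `F` that agree at `p`, so they agree at
  -- `p'`; since `F p' = F p`, this gives `p' = p`.
  have heq := hFl.eqOn_of_comp_eqOn hCp (u := id) (v := fun z => s (F z)) continuousOn_id
    (hs.cont.comp hFc hcell) hCW (fun z hz => (hs.apply_eq _ (hcell z hz)).symm) hpC hsp.symm
  have h1 := heq hpC'
  have h2 : F p' = F p := by simp only [hF, hpp]
  simp only [id, h2] at h1
  rw [h1, hsp]

/-- A proper unbranched map between planar domains with full target is injective. -/
theorem injOn_of_proper_of_isFull {f : ℂ → ℂ} {W Ω : Set ℂ} (hW : IsOpen W)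
    (hWc : IsPreconnected W) (hΩo : IsOpen Ω) (hΩc : IsPreconnected Ω) (hΩ : IsFull Ω)
    (h : MapsTo f W Ω) (hd : ∀ x ∈ W, ∃ f' ≠ 0, HasStrictDerivAt f f' x)
    (hp : ∀ C ⊆ Ω, IsCompact C → IsCompact (W ∩ f ⁻¹' C)) : InjOn f W := by
  rcases W.eq_empty_or_nonempty with rfl | hne
  · exact injOn_empty _
  · exact injOn_of_hasSections hΩ hΩo hW hWc
      (isLocalHomeomorphOn_of_hasStrictDerivAt hd).continuousOn
      (fun x hx => by
        obtain ⟨f', h0, h1⟩ := hd x hx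
        exact exists_injOn_nhds_of_hasStrictDerivAt h1 h0)
      h (surjOn_of_proper hW hΩo hΩc hne h hd hp)
      fun A hA hAo hAc => hasSections_of_isCoveringMap h
        (isCoveringMap_restrict hW hΩo h hd hp) hA hAo hAc

/-! ### Eilenberg's criterion; totally disconnected compact sets do not separate domains. -/

/-- A nonvanishing function on the plane has a continuous logarithm. On the circle it would be `log
R + t * I` up to a constant, which is not `2π`-periodic in `t`. -/
theorem false_of_nonvanishing_of_eq_on_circle {F : ℂ → ℂ} (hF : Continuous F) (h0 : ∀ z, F z ≠ 0)
    {a : ℂ} {R : ℝ} (hR : 0 < R)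
    (h : ∀ t : ℝ, F (a + R * exp (t * I)) = R * exp (t * I)) : False := by
  obtain ⟨l, ⟨-, hl⟩, -⟩ := isCoveringMapOn_exp.existsUnique_continuousMap_lifts (A := ℂ)
    ⟨F, hF⟩ (a₀ := 0) (e₀ := log (F 0)) (exp_log (h0 0)) (fun z => h0 z)
  have hl' : ∀ z, exp (l z) = F z := fun z => congrFun hl z
  have hRe : exp (Real.log R) = (R : ℂ) := by
    rw [← ofReal_exp, Real.exp_log hR]
  have key := sub_eq_sub_of_exp_eq (X := ℝ) isPreconnected_univ
    (u := fun t => l (a + R * exp (t * I))) (v := fun t => Real.log R + t * I)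
    (by fun_prop) (by fun_prop)
    (fun t _ => by rw [hl', h, exp_add, hRe]) (mem_univ 0) (mem_univ (2 * Real.pi))
  have e : exp (((2 * Real.pi : ℝ) : ℂ) * I) = exp (((0 : ℝ) : ℂ) * I) := by
    push_cast
    rw [exp_two_pi_mul_I]; simp
  simp only [e] at key
  have h2 : ((2 * Real.pi : ℝ) : ℂ) * I = ((0 : ℝ) : ℂ) * I := by linear_combination key
  have h3 := mul_right_cancel₀ I_ne_zero h2
  have h4 : (2 * Real.pi : ℝ) = 0 := by exact_mod_cast h3
  linarith [Real.pi_pos]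

theorem false_of_log_of_bounded {K : Set ℂ} (hK : IsCompact K) {a b : ℂ} (ha : a ∉ K)
    (hb : b ∉ K) {h : ℂ → ℂ} (hh : ContinuousOn h K)
    (he : ∀ z ∈ K, exp (h z) = (z - a) / (z - b))
    (hbd : Bornology.IsBounded (connectedComponentIn Kᶜ a)) :
    b ∈ connectedComponentIn Kᶜ a := by
  classical
  by_contra hbO
  set O := connectedComponentIn Kᶜ a
  have hOo : IsOpen O := hK.isClosed.isOpen_compl.connectedComponentIn
  have haO : a ∈ O := mem_connectedComponentIn ha
  have hfr : frontier O ⊆ K := fun x hx => by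
    by_contra hxK
    exact notMem_of_mem_frontier_connectedComponentIn hK.isClosed.isOpen_compl hx hxK
  obtain ⟨H, hH⟩ := ContinuousMap.exists_restrict_eq hK.isClosed
    (⟨K.domRestrict h, continuousOn_iff_continuous_domRestrict.1 hh⟩ : C(K, ℂ))
  have hH' : ∀ z ∈ K, H z = h z := fun z hz => by
    have := congrArg (fun g : C(K, ℂ) => g ⟨z, hz⟩) hH
    simpa using this
  -- With `H` a Tietze extension of `h`, the two formulas agree on `frontier O ⊆ K`. Neither
  -- vanishes where it is used, because `b ∉ O` and `a ∈ O`; and `F` is `z - a` on a circle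
  -- enclosing `O`.
  let F : ℂ → ℂ := fun z => if z ∈ O then (z - b) * exp (H z) else z - a
  have hF : Continuous F := by
    refine Continuous.if ?_ (by fun_prop) (by fun_prop)
    intro z hz
    have hzK : z ∈ K := hfr hz
    have hzb : z - b ≠ 0 := fun h => hb (by rwa [← sub_eq_zero.1 h])
    rw [hH' z hzK, he z hzK, mul_div_cancel₀ _ hzb]
  have hF0 : ∀ z, F z ≠ 0 := by
    intro z
    by_cases hz : z ∈ O
    · simp only [F, if_pos hz]
      exact mul_ne_zero (fun h => hbO (by rwa [← sub_eq_zero.1 h])) (exp_ne_zero _)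
    · simp only [F, if_neg hz]
      exact fun h => hz (by rwa [sub_eq_zero.1 h])
  obtain ⟨R, hR⟩ := hbd.subset_ball a
  have hRpos : 0 < R := by simpa using hR haO
  refine false_of_nonvanishing_of_eq_on_circle hF hF0 (a := a) hRpos fun t => ?_
  have : a + R * exp (t * I) ∉ O := fun hm => by
    have := hR hm
    simp only [mem_ball, dist_eq_norm, add_sub_cancel_left, norm_mul, norm_exp_ofReal_mul_I,
      norm_real, Real.norm_of_nonneg hRpos.le, mul_one, lt_irrefl] at this
  simp only [F, if_neg this]
  ring

theorem isPreconnected_norm_gt (R : ℝ) (hR : 0 ≤ R) : IsPreconnected {z : ℂ | R < ‖z‖} := by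
  have h : {z : ℂ | R < ‖z‖} =
      (fun q : ℝ × ℝ => (q.1 : ℂ) * exp (q.2 * I)) '' (Ioi R ×ˢ univ) := by
    ext z
    constructor
    · intro h1
      exact ⟨(‖z‖, arg z), ⟨h1, mem_univ _⟩, norm_mul_exp_arg_mul_I z⟩
    · rintro ⟨⟨s, t⟩, ⟨h1, -⟩, rfl⟩
      simp only [mem_Ioi] at h1
      rw [mem_ofPred_eq, norm_mul, norm_exp_ofReal_mul_I, mul_one, norm_real,
        Real.norm_of_nonneg (hR.trans h1.le)]
      exact h1
  rw [h]
  exact (isPreconnected_Ioi.prod isPreconnected_univ).image _ (by fun_prop)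

/-- Eilenberg's criterion: if `(z - a) / (z - b)` has a continuous logarithm on the compact set `K`,
then `K` does not separate `a` from `b`. -/
theorem mem_connectedComponentIn_compl_of_log {K : Set ℂ} (hK : IsCompact K) {a b : ℂ}
    (ha : a ∉ K) (hb : b ∉ K) {h : ℂ → ℂ} (hh : ContinuousOn h K)
    (he : ∀ z ∈ K, exp (h z) = (z - a) / (z - b)) :
    b ∈ connectedComponentIn Kᶜ a := by
  by_cases h1 : Bornology.IsBounded (connectedComponentIn Kᶜ a)
  · exact false_of_log_of_bounded hK ha hb hh he h1
  by_cases h2 : Bornology.IsBounded (connectedComponentIn Kᶜ b)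
  · exact mem_connectedComponentIn_symm (false_of_log_of_bounded hK hb ha (h := fun z => - h z)
      hh.neg (fun z hz => by rw [exp_neg, he z hz, inv_div]) h2)
  obtain ⟨R, hR⟩ := hK.isBounded.subset_closedBall (0 : ℂ)
  set R' := max R 0
  have hE : {z : ℂ | R' < ‖z‖} ⊆ Kᶜ := fun z hz hzK => by
    have h3 : ‖z‖ ≤ R := by simpa using hR hzK
    have h4 : R' < ‖z‖ := hz
    linarith [le_max_left R 0]
  have key : ∀ c, ¬ Bornology.IsBounded (connectedComponentIn Kᶜ c) →
      ∃ q ∈ connectedComponentIn Kᶜ c, R' < ‖q‖ := by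
    intro c hc
    by_contra! hcon
    exact hc (isBounded_closedBall.subset (t := closedBall 0 R') fun q hq => by
      simpa using hcon q hq)
  obtain ⟨p, hp, hpR⟩ := key a h1
  obtain ⟨q, hq, hqR⟩ := key b h2
  have h5 := (isPreconnected_norm_gt R' (le_max_right _ _)).subset_connectedComponentIn hpR hE hqR
  exact mem_connectedComponentIn_trans (mem_connectedComponentIn_trans hp h5)
    (mem_connectedComponentIn_symm hq)

/-- A totally disconnected compact set does not disconnect a disk. -/
theorem isPreconnected_ball_diff {J : Set ℂ} (hJ : IsCompact J) (hJt : IsTotallyDisconnected J)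
    (x : ℂ) (r : ℝ) : IsPreconnected (ball x r \ J) := by
  classical
  refine isPreconnected_of_forall_pair fun a ha b hb => ?_
  set J' := J ∩ closedBall x r with hJ'
  have hJ'c : IsCompact J' := hJ.inter_right isClosed_closedBall
  set K := J' ∪ sphere x r with hKdef
  have hK : IsCompact K := hJ'c.union (isCompact_sphere x r)
  have hnot : ∀ c ∈ ball x r \ J, c ∉ K := by
    rintro c ⟨hc, hcJ⟩ (h | h)
    · exact hcJ h.1
    · rw [mem_ball] at hc
      exact hc.ne h
  set F : ℂ → ℂ := fun z => (z - a) / (z - b) with hF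
  have hzb : ∀ z ∈ K, z - b ≠ 0 := fun z hz h => hnot b hb (by rwa [← sub_eq_zero.1 h])
  have hza : ∀ z ∈ K, z - a ≠ 0 := fun z hz h => hnot a ha (by rwa [← sub_eq_zero.1 h])
  have hF0 : ∀ z ∈ K, F z ≠ 0 := fun z hz => div_ne_zero (hza z hz) (hzb z hz)
  have hFc : ContinuousOn F K := ContinuousOn.div (by fun_prop) (by fun_prop) hzb
  have hsph : ∀ z ∈ sphere x r, F z ∈ slitPlane := by
    intro z hz
    refine div_sub_mem_slitPlane_of_notMem_segment fun hs => ?_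
    have := (convex_ball x r).segment_subset ha.1 hb.1 hs
    rw [mem_ball] at this
    exact this.ne hz
  have : CompactSpace J' := isCompact_iff_compactSpace.1 hJ'c
  have : TotallyDisconnectedSpace J' := by
    rw [totallyDisconnectedSpace_subtype_iff]
    exact fun t ht hp => hJt t (ht.trans inter_subset_left) hp
  have hFJ : Continuous fun z : J' => F z :=
    continuousOn_iff_continuous_domRestrict.1 (hFc.mono subset_union_left)
  -- Total disconnectedness isolates the points of `J'` where the principal logarithm of `F` fails
  -- in a clopen piece `C`, off the sphere, on which `F` has negative real part. There `log (-F) + π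
  -- I` serves instead.
  obtain ⟨C, hC, hZC, hCU⟩ := exists_clopen_of_closed_subset_open (X := J')
    (Z := {z | F z ∉ slitPlane}) (U := {z | (F z).re < 0} ∩ {z | (z : ℂ) ∉ sphere x r})
    (isOpen_slitPlane.preimage hFJ).isClosed_compl
    ((isOpen_lt (continuous_re.comp hFJ) continuous_const).inter
      (isClosed_sphere.isOpen_compl.preimage continuous_subtype_val))
    (fun z hz => by
      refine ⟨?_, fun h => hz (hsph z h)⟩
      simp only [mem_ofPred_eq, mem_slitPlane_iff, not_or, not_lt, not_not] at hz ⊢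
      exact lt_of_le_of_ne hz.1 fun h => hF0 z (Or.inl z.2) (Complex.ext h hz.2))
  set P : Set ℂ := Subtype.val '' C
  set Q : Set ℂ := Subtype.val '' Cᶜ ∪ sphere x r
  have hPc : IsClosed P := (hC.1.isCompact.image continuous_subtype_val).isClosed
  have hQc : IsClosed Q :=
    (hC.compl.1.isCompact.image continuous_subtype_val).isClosed.union isClosed_sphere
  have hKPQ : K ⊆ P ∪ Q := by
    rintro z (hz | hz)
    · by_cases h : (⟨z, hz⟩ : J') ∈ C
      · exact Or.inl ⟨_, h, rfl⟩
      · exact Or.inr (Or.inl ⟨_, h, rfl⟩)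
    · exact Or.inr (Or.inr hz)
  have hPK : P ⊆ K := by rintro _ ⟨z, -, rfl⟩; exact Or.inl z.2
  have hQK : Q ⊆ K := by
    rintro z (⟨z, -, rfl⟩ | hz)
    · exact Or.inl z.2
    · exact Or.inr hz
  have hQP : ∀ z ∈ Q, z ∉ P := by
    rintro z (⟨z, hz, rfl⟩ | hz) ⟨u, hu, huz⟩
    · exact hz (by rwa [← Subtype.ext huz])
    · exact (hCU hu).2 (by rwa [huz])
  have hPF : ∀ z ∈ P, - F z ∈ slitPlane := by
    rintro _ ⟨z, hz, rfl⟩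
    have := (hCU hz).1
    exact Or.inl (by simpa using this)
  have hQF : ∀ z ∈ Q, F z ∈ slitPlane := by
    rintro z (⟨z, hz, rfl⟩ | hz)
    · by_contra h
      exact hz (hZC h)
    · exact hsph z hz
  let h : ℂ → ℂ := fun z => if z ∈ P then log (- F z) + Real.pi * I else log (F z)
  have hhP : ContinuousOn h P :=
    (((hFc.mono hPK).neg.clog hPF).add continuousOn_const).congr fun z hz => if_pos hz
  have hhQ : ContinuousOn h Q :=
    ((hFc.mono hQK).clog hQF).congr fun z hz => if_neg (hQP z hz)
  have hh : ContinuousOn h K := (hhP.union_of_isClosed hhQ hPc hQc).mono hKPQ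
  have he : ∀ z ∈ K, exp (h z) = (z - a) / (z - b) := by
    intro z hz
    by_cases hzP : z ∈ P
    · simp only [h, if_pos hzP]
      rw [exp_add, exp_log (neg_ne_zero.2 (hF0 z hz)), exp_pi_mul_I]
      simp [F]
    · simp only [h, if_neg hzP]
      rw [exp_log (hF0 z hz)]
  have hmem := mem_connectedComponentIn_compl_of_log hK (hnot a ha) (hnot b hb) hh he
  have haC : a ∈ connectedComponentIn Kᶜ a := mem_connectedComponentIn (hnot a ha)
  -- The sphere was included in `K` for this: the component cannot leave the ball.
  have hsub : connectedComponentIn Kᶜ a ⊆ ball x r := by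
    intro y hy
    by_contra hyb
    obtain ⟨u, hu, hu'⟩ := inter_frontier_nonempty_of_isPreconnected
      (isPreconnected_connectedComponentIn (x := a) (F := Kᶜ)) isOpen_ball ⟨a, haC, ha.1⟩
      ⟨y, hy, hyb⟩
    exact connectedComponentIn_subset _ _ hu (Or.inr (frontier_ball_subset_sphere hu'))
  refine ⟨connectedComponentIn Kᶜ a, fun y hy => ⟨hsub hy, fun hyJ => ?_⟩, haC, hmem,
    isPreconnected_connectedComponentIn⟩
  exact connectedComponentIn_subset _ _ hy (Or.inl ⟨hyJ, ball_subset_closedBall (hsub hy)⟩)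

theorem ball_diff_nonempty {J : Set ℂ} (hJt : IsTotallyDisconnected J) (x : ℂ) {r : ℝ}
    (hr : 0 < r) : (ball x r \ J).Nonempty := by
  by_contra h
  rw [not_nonempty_iff_eq_empty, sdiff_eq_empty] at h
  have := hJt _ h (convex_ball x r).isPreconnected
  have h1 := this (mem_ball_self hr) (show x + (r / 2 : ℝ) ∈ ball x r by
    rw [mem_ball, dist_eq_norm, add_sub_cancel_left, norm_real, Real.norm_of_nonneg (by positivity)]
    linarith)
  have h2 : ((r / 2 : ℝ) : ℂ) = 0 := by linear_combination -h1
  have h3 : r / 2 = 0 := by exact_mod_cast h2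
  linarith

theorem subset_closure_diff {J W : Set ℂ} (hJt : IsTotallyDisconnected J) (hW : IsOpen W) :
    W ⊆ closure (W \ J) := by
  intro x hx
  rw [mem_closure_iff_nhds_basis nhds_basis_ball]
  intro r hr
  obtain ⟨e, he, heW⟩ := Metric.isOpen_iff.1 hW x hx
  obtain ⟨y, hy, hyJ⟩ := ball_diff_nonempty hJt x (lt_min hr he)
  exact ⟨y, ⟨heW (ball_subset_ball (min_le_right _ _) hy), hyJ⟩,
    ball_subset_ball (min_le_left _ _) hy⟩

/-- A totally disconnected compact set does not disconnect a planar domain. -/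
theorem isPreconnected_diff {J W : Set ℂ} (hJ : IsCompact J) (hJt : IsTotallyDisconnected J)
    (hW : IsOpen W) (hWc : IsPreconnected W) : IsPreconnected (W \ J) := by
  intro u v hu hv huv hune hvne
  by_contra hcon
  -- A ball in `W` minus `J` is connected, so it lies wholly in `u` or in `v`. Thus `N u` and `N v`
  -- are open and cover `W`, and a common point gives a point of `u ∩ v` off `J`.
  let N : Set ℂ → Set ℂ := fun u => {x | ∃ r > 0, ball x r ⊆ W ∧ ball x r \ J ⊆ u}
  have hN : ∀ u, IsOpen (N u) := by
    intro u
    rw [Metric.isOpen_iff]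
    rintro x ⟨r, hr, h1, h2⟩
    refine ⟨r / 2, by positivity, fun y hy => ⟨r / 2, by positivity, ?_, ?_⟩⟩
    · refine Subset.trans (ball_subset_ball' ?_) h1
      rw [mem_ball] at hy
      linarith
    · refine Subset.trans (sdiff_subset_sdiff_left (ball_subset_ball' ?_)) h2
      rw [mem_ball] at hy
      linarith
  have hmemN : ∀ u, IsOpen u → ∀ x ∈ (W \ J) ∩ u, x ∈ N u := by
    rintro u hu x ⟨⟨hxW, -⟩, hxu⟩
    obtain ⟨e, he, heW⟩ := Metric.isOpen_iff.1 (hW.inter hu) x ⟨hxW, hxu⟩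
    exact ⟨e, he, heW.trans inter_subset_left, sdiff_subset.trans (heW.trans inter_subset_right)⟩
  have hcov : W ⊆ N u ∪ N v := by
    intro x hx
    obtain ⟨e, he, heW⟩ := Metric.isOpen_iff.1 hW x hx
    have hsub : ball x e \ J ⊆ u ∪ v := (sdiff_subset_sdiff_left heW).trans huv
    have hdisj : ¬ (ball x e \ J ∩ (u ∩ v)).Nonempty := fun ⟨y, hy⟩ =>
      hcon ⟨y, ⟨heW hy.1.1, hy.1.2⟩, hy.2⟩
    by_cases h1 : (ball x e \ J ∩ u).Nonempty
    · left
      refine ⟨e, he, heW, fun y hy => ?_⟩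
      by_contra hyu
      exact hdisj (isPreconnected_ball_diff hJ hJt x e u v hu hv hsub h1
        ⟨y, hy, (hsub hy).resolve_left hyu⟩)
    · right
      exact ⟨e, he, heW, fun y hy => (hsub hy).resolve_left fun h => h1 ⟨y, hy, h⟩⟩
  obtain ⟨x, hx, ⟨r, hr, h1, h2⟩, ⟨r', hr', h1', h2'⟩⟩ := hWc (N u) (N v) (hN u) (hN v) hcov
    (hune.imp fun x hx => ⟨hx.1.1, hmemN u hu x hx⟩) (hvne.imp fun x hx => ⟨hx.1.1, hmemN v hv x hx⟩)
  obtain ⟨y, hy, hyJ⟩ := ball_diff_nonempty hJt x (lt_min hr hr')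
  have hy1 := ball_subset_ball (min_le_left r r') hy
  have hy2 := ball_subset_ball (min_le_right r r') hy
  exact hcon ⟨y, ⟨h1 hy1, hyJ⟩, h2 ⟨hy1, hyJ⟩, h2' ⟨hy2, hyJ⟩⟩

/-! ### Iterated preimages of `U` and their components. -/

section Dynamics

variable {d N : ℕ} {f : ℂ → ℂ} {U' U : Set ℂ} {Ui : Fin N → Set ℂ}

theorem IsGenPolyLike.isOpen_domain (hf : IsGenPolyLike f U' U Ui d) : IsOpen U' := by
  rw [hf.domain_eq]
  exact isOpen_iUnion fun i => (hf.disk_piece i).1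

theorem IsGenPolyLike.isOpen_pullback (hf : IsGenPolyLike f U' U Ui d) (k : ℕ) :
    IsOpen (pullback f U' U k) := by
  induction k with
  | zero => exact hf.disk_range.1
  | succ k ih => exact hf.holo.continuousOn.isOpen_inter_preimage hf.isOpen_domain ih

theorem IsGenPolyLike.domain_subset (hf : IsGenPolyLike f U' U Ui d) : U' ⊆ U :=
  subset_closure.trans hf.closure_subset

theorem IsGenPolyLike.pullback_succ_subset (hf : IsGenPolyLike f U' U Ui d) (k : ℕ) :
    pullback f U' U (k + 1) ⊆ pullback f U' U k := by
  induction k with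
  | zero => exact fun z hz => hf.domain_subset hz.1
  | succ k ih => exact fun z hz => ⟨hz.1, ih hz.2⟩

theorem IsGenPolyLike.pullback_subset (hf : IsGenPolyLike f U' U Ui d) (k : ℕ) :
    pullback f U' U k ⊆ U := by
  induction k with
  | zero => exact subset_rfl
  | succ k ih => exact (hf.pullback_succ_subset k).trans ih

theorem iterate_mem_of_mem_pullback {k : ℕ} {z : ℂ} (hz : z ∈ pullback f U' U (k + 1)) :
    f^[k] z ∈ U' := by
  induction k generalizing z with
  | zero => exact hz.1
  | succ k ih => exact ih hz.2

theorem apply_mem_filledJulia_iff {z : ℂ} (hz : z ∈ U') :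
    f z ∈ filledJulia f U' ↔ z ∈ filledJulia f U' := by
  constructor
  · rintro h (_ | n)
    · exact hz
    · exact h n
  · exact fun h n => h (n + 1)

theorem IsGenPolyLike.isCompact_preimage (hf : IsGenPolyLike f U' U Ui d) {C : Set ℂ}
    (hC : IsCompact C) (hCU : C ⊆ U) : IsCompact (U' ∩ f ⁻¹' C) := by
  obtain ⟨h, hp⟩ := hf.proper
  have h1 : IsCompact ((Subtype.val : U → ℂ) ⁻¹' C) := by
    rw [Subtype.isCompact_iff, Subtype.image_preimage_coe, inter_eq_right.2 hCU]
    exact hC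
  have h2 := (hp.isCompact_preimage h1).image continuous_subtype_val
  convert h2 using 1
  ext z
  constructor
  · rintro ⟨hz, hk⟩
    exact ⟨⟨z, hz⟩, hk, rfl⟩
  · rintro ⟨z, hk, rfl⟩
    exact ⟨z.2, hk⟩

theorem IsGenPolyLike.exists_compact_between (hf : IsGenPolyLike f U' U Ui d) (k : ℕ) :
    ∃ C, IsCompact C ∧ pullback f U' U (k + 1) ⊆ C ∧ C ⊆ pullback f U' U k := by
  induction k with
  | zero =>
    exact ⟨closure U', hf.compact_closure, fun z hz => subset_closure hz.1, hf.closure_subset⟩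
  | succ k ih =>
    obtain ⟨C, hC, h1, h2⟩ := ih
    exact ⟨U' ∩ f ⁻¹' C, hf.isCompact_preimage hC (h2.trans (hf.pullback_subset k)),
      fun z hz => ⟨hz.1, h1 hz.2⟩, fun z hz => ⟨hz.1, h2 hz.2⟩⟩

theorem IsGenPolyLike.closure_pullback_subset (hf : IsGenPolyLike f U' U Ui d) (k : ℕ) :
    closure (pullback f U' U (k + 1)) ⊆ pullback f U' U k := by
  obtain ⟨C, hC, h1, h2⟩ := hf.exists_compact_between k
  exact (hC.isClosed.closure_subset_iff.2 h1).trans h2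

theorem IsGenPolyLike.isCompact_closure_pullback (hf : IsGenPolyLike f U' U Ui d) (k : ℕ) :
    IsCompact (closure (pullback f U' U (k + 1))) := by
  obtain ⟨C, hC, h1, h2⟩ := hf.exists_compact_between k
  exact hC.of_isClosed_subset isClosed_closure (hC.isClosed.closure_subset_iff.2 h1)

theorem IsGenPolyLike.hasStrictDerivAt (hf : IsGenPolyLike f U' U Ui d) {z : ℂ} (hz : z ∈ U') :
    HasStrictDerivAt f (deriv f z) z :=
  (hf.holo.analyticAt (hf.isOpen_domain.mem_nhds hz)).hasStrictDerivAt

theorem IsGenPolyLike.locInjOn (hf : IsGenPolyLike f U' U Ui d)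
    (hcrit : ∀ c, IsCriticalPoint f U' c → c ∈ filledJulia f U') :
    LocInjOn f (U' \ filledJulia f U') := fun z hz =>
  exists_injOn_nhds_of_hasStrictDerivAt (hf.hasStrictDerivAt hz.1)
    fun h => hz.2 (hcrit z ⟨hz.1, h⟩)

theorem IsGenPolyLike.locInjOn_iterate (hf : IsGenPolyLike f U' U Ui d)
    (hcrit : ∀ c, IsCriticalPoint f U' c → c ∈ filledJulia f U') (k : ℕ) :
    LocInjOn f^[k] (pullback f U' U k \ filledJulia f U') := by
  induction k with
  | zero => exact fun z _ => ⟨univ, univ_mem, fun x _ y _ h => h⟩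
  | succ k ih =>
    rintro z ⟨hz, hzK⟩
    obtain ⟨N₁, hN₁, h1⟩ := hf.locInjOn hcrit z ⟨hz.1, hzK⟩
    obtain ⟨N₂, hN₂, h2⟩ := ih (f z) ⟨hz.2, fun h => hzK ((apply_mem_filledJulia_iff hz.1).1 h)⟩
    have hc : ContinuousAt f z := (hf.hasStrictDerivAt hz.1).hasDerivAt.continuousAt
    exact ⟨N₁ ∩ f ⁻¹' N₂, inter_mem hN₁ (hc hN₂), fun x hx y hy h => h1 hx.1 hy.1 (h2 hx.2 hy.2 h)⟩

theorem IsGenPolyLike.continuousOn_iterate (hf : IsGenPolyLike f U' U Ui d) (k : ℕ) :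
    ContinuousOn f^[k] (pullback f U' U k) := by
  induction k with
  | zero => exact continuousOn_id
  | succ k ih =>
    exact ih.comp (hf.holo.continuousOn.mono fun z hz => hz.1) fun z hz => hz.2

theorem iterate_mem_range {k : ℕ} {z : ℂ} (hz : z ∈ pullback f U' U k \ filledJulia f U') :
    f^[k] z ∈ U \ filledJulia f U' := by
  induction k generalizing z with
  | zero => exact hz
  | succ k ih =>
    exact ih ⟨hz.1.2, fun h => hz.2 ((apply_mem_filledJulia_iff hz.1.1).1 h)⟩

theorem IsGenPolyLike.component_subset_piece (hf : IsGenPolyLike f U' U Ui d) {T : Set ℂ}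
    (hT : IsPreconnected T) (hTU : T ⊆ U') {z : ℂ} {i : Fin N} (hz : z ∈ T) (hzi : z ∈ Ui i) :
    T ⊆ Ui i := by
  refine hT.subset_left_of_subset_union (hf.disk_piece i).1
    (isOpen_iUnion fun j : {j // j ≠ i} => (hf.disk_piece j).1) ?_ ?_ ⟨z, hz, hzi⟩
  · exact disjoint_iUnion_right.2 fun j => hf.disjoint_piece i j j.2.symm
  · intro x hx
    have := hTU hx
    rw [hf.domain_eq] at this
    obtain ⟨j, hj⟩ := mem_iUnion.1 this
    by_cases hji : j = i
    · exact Or.inl (hji ▸ hj)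
    · exact Or.inr (mem_iUnion.2 ⟨⟨j, hji⟩, hj⟩)

theorem IsGenPolyLike.mapsTo_component (hf : IsGenPolyLike f U' U Ui d) {k : ℕ} {z : ℂ}
    (hz : z ∈ pullback f U' U (k + 1)) :
    MapsTo f (connectedComponentIn (pullback f U' U (k + 1)) z)
      (connectedComponentIn (pullback f U' U k) (f z)) := by
  have hsub := connectedComponentIn_subset (pullback f U' U (k + 1)) z
  refine mapsTo_iff_image_subset.2 ((isPreconnected_connectedComponentIn.image f
    (hf.holo.continuousOn.mono fun x hx => (hsub hx).1)).subset_connectedComponentIn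
    ⟨z, mem_connectedComponentIn hz, rfl⟩ ?_)
  rintro _ ⟨x, hx, rfl⟩
  exact (hsub hx).2

/-- A component at level `k + 1` lies in a single piece `Ui i`, hence is a component of the
preimage, inside this full disk, of a full component at level `k`. -/
theorem IsGenPolyLike.isFull_component (hf : IsGenPolyLike f U' U Ui d) (k : ℕ) {z : ℂ}
    (hz : z ∈ pullback f U' U k) : IsFull (connectedComponentIn (pullback f U' U k) z) := by
  induction k generalizing z with
  | zero =>
    rw [show pullback f U' U 0 = U from rfl,
      hf.disk_range.isPreconnected.connectedComponentIn hz]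
    exact hf.disk_range.isFull
  | succ k ih =>
    obtain ⟨i, hi⟩ : ∃ i, z ∈ Ui i := by
      have := hz.1
      rwa [hf.domain_eq, mem_iUnion] at this
    have hUi : Ui i ⊆ U' := by rw [hf.domain_eq]; exact subset_iUnion _ i
    have key : connectedComponentIn (pullback f U' U (k + 1)) z = connectedComponentIn
        {x | x ∈ Ui i ∧ f x ∈ connectedComponentIn (pullback f U' U k) (f z)} z := by
      apply subset_antisymm
      · refine isPreconnected_connectedComponentIn.subset_connectedComponentIn
          (mem_connectedComponentIn hz) fun x hx => ⟨?_, hf.mapsTo_component hz hx⟩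
        exact hf.component_subset_piece isPreconnected_connectedComponentIn
          (fun y hy => (connectedComponentIn_subset _ _ hy).1) (mem_connectedComponentIn hz) hi hx
      · exact connectedComponentIn_mono _ fun x hx =>
          ⟨hUi hx.1, connectedComponentIn_subset _ _ hx.2⟩
    rw [key]
    exact (hf.disk_piece i).isFull.connectedComponentIn_preimage (hf.disk_piece i).1
      (hf.disk_piece i).isPreconnected (hf.holo.mono hUi) (ih hz.2)
      (hf.isOpen_pullback k).connectedComponentIn z

/-- Properness of `f` on one component: a component is relatively closed in `f⁻ᵏ⁻¹(U)`, so it cuts a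
compact piece out of the compact set `U' ∩ f ⁻¹' C`. -/
theorem IsGenPolyLike.isCompact_component_inter (hf : IsGenPolyLike f U' U Ui d) {k : ℕ} {z : ℂ}
    {C : Set ℂ} (hC : IsCompact C) (hCk : C ⊆ pullback f U' U k) :
    IsCompact (connectedComponentIn (pullback f U' U (k + 1)) z ∩ f ⁻¹' C) := by
  set W := connectedComponentIn (pullback f U' U (k + 1)) z with hW
  have h1 := hf.isCompact_preimage hC (hCk.trans (hf.pullback_subset k))
  have hsub : W ⊆ pullback f U' U (k + 1) := connectedComponentIn_subset _ _
  have h2 : W ∩ f ⁻¹' C = closure W ∩ (U' ∩ f ⁻¹' C) := by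
    apply subset_antisymm
    · exact fun x hx => ⟨subset_closure hx.1, (hsub hx.1).1, hx.2⟩
    · rintro x ⟨hx, hxU, hxC⟩
      refine ⟨?_, hxC⟩
      by_contra hxW
      refine notMem_of_mem_frontier_connectedComponentIn (hf.isOpen_pullback (k + 1)) (x := z)
        (y := x) ?_ ⟨hxU, hCk hxC⟩
      rw [(hf.isOpen_pullback (k + 1)).connectedComponentIn.frontier_eq]
      exact ⟨hx, hxW⟩
  rw [h2]
  exact h1.inter_left isClosed_closure

/-- On a component of `f⁻ᵏ⁻¹(U)` without critical points `f` is injective. -/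
theorem IsGenPolyLike.injOn_component (hf : IsGenPolyLike f U' U Ui d) {k : ℕ} {W : Set ℂ}
    (hW : IsComponentOf W (pullback f U' U (k + 1)))
    (hc : ∀ c ∈ W, ¬ IsCriticalPoint f U' c) : InjOn f W := by
  obtain ⟨z, hz, rfl⟩ := hW
  have hsub := connectedComponentIn_subset (pullback f U' U (k + 1)) z
  exact injOn_of_proper_of_isFull (hf.isOpen_pullback _).connectedComponentIn
    isPreconnected_connectedComponentIn (hf.isOpen_pullback k).connectedComponentIn
    isPreconnected_connectedComponentIn (hf.isFull_component k hz.2) (hf.mapsTo_component hz)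
    (fun x hx => ⟨deriv f x, fun h => hc x hx ⟨(hsub hx).1, h⟩, hf.hasStrictDerivAt (hsub hx).1⟩)
    fun C hC hCc => hf.isCompact_component_inter hCc (hC.trans (connectedComponentIn_subset _ _))

theorem IsComponentOf.subset {W A : Set ℂ} (h : IsComponentOf W A) : W ⊆ A := by
  obtain ⟨z, -, rfl⟩ := h
  exact connectedComponentIn_subset _ _

theorem IsComponentOf.isPreconnected {W A : Set ℂ} (h : IsComponentOf W A) :
    IsPreconnected W := by
  obtain ⟨z, -, rfl⟩ := h
  exact isPreconnected_connectedComponentIn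

theorem IsComponentOf.eq_of_mem {W W' A : Set ℂ} (h : IsComponentOf W A) (h' : IsComponentOf W' A)
    {x : ℂ} (hx : x ∈ W) (hx' : x ∈ W') : W = W' := by
  obtain ⟨z, -, rfl⟩ := h
  obtain ⟨z', -, rfl⟩ := h'
  rw [connectedComponentIn_eq hx, connectedComponentIn_eq hx']

theorem IsComponentOf.subset_of_preconnected {W A T : Set ℂ} (h : IsComponentOf W A)
    (hT : IsPreconnected T) (hTA : T ⊆ A) {x : ℂ} (hx : x ∈ W) (hxT : x ∈ T) : T ⊆ W := by
  obtain ⟨z, -, rfl⟩ := h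
  rw [connectedComponentIn_eq hx]
  exact hT.subset_connectedComponentIn hxT hTA

end Dynamics

/-! ### Compositions of lifted inverse branches and their images under `φ`. -/

section Chains

variable {d N : ℕ} {f : ℂ → ℂ} {U' U : Set ℂ} {Ui : Fin N → Set ℂ} {φ : ℂ → ℂ}
  {g : Fin d → ℂ → ℂ}

theorem chain_mapsTo (hg : ∀ j, IsInverseLift f U' φ (g j)) :
    ∀ (k : ℕ) (ε : Fin k → Fin d) (δ : Fin k → ℂ → ℂ), (∀ l, IsDeck φ (δ l)) →
      MapsTo (chain g k ε δ) disk disk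
  | 0, _, _, _ => mapsTo_id _
  | k + 1, ε, δ, hδ => fun _ hz => (hδ 0).bij.mapsTo ((hg (ε 0)).mapsTo
      (chain_mapsTo hg k (Fin.tail ε) (Fin.tail δ) (fun l => hδ l.succ) hz))

theorem chain_continuousOn (hg : ∀ j, IsInverseLift f U' φ (g j)) :
    ∀ (k : ℕ) (ε : Fin k → Fin d) (δ : Fin k → ℂ → ℂ), (∀ l, IsDeck φ (δ l)) →
      ContinuousOn (chain g k ε δ) disk
  | 0, _, _, _ => continuousOn_id
  | k + 1, ε, δ, hδ => by
    have hm := chain_mapsTo hg k (Fin.tail ε) (Fin.tail δ) (fun l => hδ l.succ)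
    exact (hδ 0).holo.continuousOn.comp ((hg (ε 0)).holo.continuousOn.comp
      (chain_continuousOn hg k (Fin.tail ε) (Fin.tail δ) (fun l => hδ l.succ)) hm)
      ((hg (ε 0)).mapsTo.comp hm)

theorem chain_congr (hg : ∀ j, IsInverseLift f U' φ (g j)) :
    ∀ (k : ℕ) (ε : Fin k → Fin d) (δ δ' : Fin k → ℂ → ℂ), (∀ l, IsDeck φ (δ l)) →
      (∀ l, EqOn (δ l) (δ' l) disk) → EqOn (chain g k ε δ) (chain g k ε δ') disk
  | 0, _, _, _, _, _ => fun _ _ => rfl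
  | k + 1, ε, δ, δ', hδ, h => fun z hz => by
    have hm := chain_mapsTo hg k (Fin.tail ε) (Fin.tail δ) (fun l => hδ l.succ) hz
    have hc := chain_congr hg k (Fin.tail ε) (Fin.tail δ) (Fin.tail δ') (fun l => hδ l.succ)
      (fun l => h l.succ) hz
    simp only [chain]
    rw [h 0 ((hg (ε 0)).mapsTo hm), hc]

theorem φ_chain_succ (hg : ∀ j, IsInverseLift f U' φ (g j)) {k : ℕ} {ε : Fin (k + 1) → Fin d}
    {δ : Fin (k + 1) → ℂ → ℂ} (hδ : ∀ l, IsDeck φ (δ l)) {z : ℂ} (hz : z ∈ disk) :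
    φ (chain g (k + 1) ε δ z) = φ (g (ε 0) (chain g k (Fin.tail ε) (Fin.tail δ) z)) :=
  (hδ 0).comm _ ((hg (ε 0)).mapsTo
    (chain_mapsTo hg k (Fin.tail ε) (Fin.tail δ) (fun l => hδ l.succ) hz))

theorem apply_φ_chain_succ (hg : ∀ j, IsInverseLift f U' φ (g j)) {k : ℕ} {ε : Fin (k + 1) → Fin d}
    {δ : Fin (k + 1) → ℂ → ℂ} (hδ : ∀ l, IsDeck φ (δ l)) {z : ℂ} (hz : z ∈ disk) :
    f (φ (chain g (k + 1) ε δ z)) = φ (chain g k (Fin.tail ε) (Fin.tail δ) z) := by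
  rw [φ_chain_succ hg hδ hz]
  exact (hg (ε 0)).lift _ (chain_mapsTo hg k (Fin.tail ε) (Fin.tail δ) (fun l => hδ l.succ) hz)

theorem φ_chain_mem (hg : ∀ j, IsInverseLift f U' φ (g j))
    (hφ : MapsTo φ disk (U \ filledJulia f U')) :
    ∀ (k : ℕ) (ε : Fin k → Fin d) (δ : Fin k → ℂ → ℂ), (∀ l, IsDeck φ (δ l)) → ∀ z ∈ disk,
      φ (chain g k ε δ z) ∈ pullback f U' U k \ filledJulia f U'
  | 0, _, _, _ => fun _ hz => hφ hz
  | k + 1, ε, δ, hδ => fun z hz => by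
    have h1 := φ_chain_mem hg hφ k (Fin.tail ε) (Fin.tail δ) (fun l => hδ l.succ) z hz
    have h2 : φ (chain g (k + 1) ε δ z) ∈ U' := by
      rw [φ_chain_succ hg hδ hz]
      exact (hg (ε 0)).mem_domain _
        (chain_mapsTo hg k (Fin.tail ε) (Fin.tail δ) (fun l => hδ l.succ) hz)
    rw [← apply_φ_chain_succ hg hδ hz] at h1
    exact ⟨⟨h2, h1.1⟩, fun h => h1.2 ((apply_mem_filledJulia_iff h2).2 h)⟩

theorem iterate_φ_chain (hg : ∀ j, IsInverseLift f U' φ (g j)) :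
    ∀ (k : ℕ) (ε : Fin k → Fin d) (δ : Fin k → ℂ → ℂ), (∀ l, IsDeck φ (δ l)) → ∀ z ∈ disk,
      f^[k] (φ (chain g k ε δ z)) = φ z
  | 0, _, _, _ => fun _ _ => rfl
  | k + 1, ε, δ, hδ => fun z hz => by
    rw [Function.iterate_succ_apply, apply_φ_chain_succ hg hδ hz]
    exact iterate_φ_chain hg k (Fin.tail ε) (Fin.tail δ) (fun l => hδ l.succ) z hz

theorem IsUniversalCovering.mapsTo {A : Set ℂ} (h : IsUniversalCovering φ A) : MapsTo φ disk A :=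
  h.covering.1

/-- The image of a composition of inverse branches is a punctured component of `f⁻ᵏ(U)`. -/
theorem exists_component_image_chain (hf : IsGenPolyLike f U' U Ui d)
    (hKc : IsCompact (filledJulia f U')) (hKt : IsTotallyDisconnected (filledJulia f U'))
    (hcrit : ∀ c, IsCriticalPoint f U' c → c ∈ filledJulia f U')
    (hφ : IsUniversalCovering φ (U \ filledJulia f U'))
    (hg : ∀ j, IsInverseLift f U' φ (g j)) (k : ℕ) (ε : Fin k → Fin d) (δ : Fin k → ℂ → ℂ)
    (hδ : ∀ l, IsDeck φ (δ l)) :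
    ∃ W, IsComponentOf W (pullback f U' U k) ∧
      φ '' (chain g k ε δ '' disk) = W \ filledJulia f U' := by
  set K := filledJulia f U'
  obtain ⟨hφm, cov⟩ := hφ.covering
  have hmem := φ_chain_mem hg hφm k ε δ hδ
  have h0 : (0 : ℂ) ∈ disk := by simp
  have hΦc : ContinuousOn (fun z => φ (chain g k ε δ z)) disk :=
    hφ.holo.continuousOn.comp (chain_continuousOn hg k ε δ hδ) (chain_mapsTo hg k ε δ hδ)
  set W := connectedComponentIn (pullback f U' U k) (φ (chain g k ε δ 0)) with hW
  have hWsub : W ⊆ pullback f U' U k := connectedComponentIn_subset _ _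
  have hWo : IsOpen W := (hf.isOpen_pullback k).connectedComponentIn
  refine ⟨W, ⟨_, (hmem 0 h0).1, rfl⟩, ?_⟩
  rw [image_image]
  apply subset_antisymm
  · rintro _ ⟨z, hz, rfl⟩
    refine ⟨?_, (hmem z hz).2⟩
    refine ((convex_ball (0 : ℂ) 1).isPreconnected.image _ hΦc).subset_connectedComponentIn
      ⟨0, h0, rfl⟩ ?_ ⟨z, hz, rfl⟩
    rintro _ ⟨y, hy, rfl⟩
    exact (hmem y hy).1
  · intro q hq
    have h0W : φ (chain g k ε δ 0) ∈ W \ K :=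
      ⟨mem_connectedComponentIn (hmem 0 h0).1, (hmem 0 h0).2⟩
    have hpath : IsPathConnected (W \ K) :=
      (hWo.sdiff hKc.isClosed).isConnected_iff_isPathConnected.1
        ⟨⟨q, hq⟩, isPreconnected_diff hKc hKt hWo isPreconnected_connectedComponentIn⟩
    have hj := hpath.joinedIn _ h0W q hq
    set β := hj.somePath
    have hβ : ∀ t, β t ∈ W \ K := hj.somePath_mem
    have hβk : ∀ t, β t ∈ pullback f U' U k \ K := fun t => ⟨hWsub (hβ t).1, (hβ t).2⟩
    -- The path `β` to `q` is pushed forward by `f^[k]` and lifted through `φ` to a path `G` from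
    -- `0`. Then `β` and `φ ∘ chain ∘ G` have the same image under `f^[k]` and the same start, so
    -- they coincide, and `q` is attained.
    let p : C(unitInterval, ↥(U \ K)) :=
      ⟨fun t => ⟨f^[k] (β t), iterate_mem_range (hβk t)⟩,
        ((hf.continuousOn_iterate k).comp_continuous β.continuous
          fun t => (hβk t).1).subtype_mk _⟩
    have hp0 : p 0 = hφm.restrict φ disk (U \ K) ⟨0, h0⟩ := by
      apply Subtype.ext
      change f^[k] (β 0) = φ 0
      rw [β.source, iterate_φ_chain hg k ε δ hδ 0 h0]
    let G := cov.liftPath p ⟨0, h0⟩ hp0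
    have hG : ∀ t, φ (G t) = f^[k] (β t) := fun t =>
      congrArg Subtype.val (congrFun (cov.liftPath_lifts p ⟨0, h0⟩ hp0) t)
    have hG0 : G 0 = ⟨0, h0⟩ := cov.liftPath_zero p ⟨0, h0⟩ hp0
    have heq := (hf.locInjOn_iterate hcrit k).eqOn_of_comp_eqOn (X := unitInterval)
      isPreconnected_univ (u := β) (v := fun t => φ (chain g k ε δ (G t)))
      β.continuous.continuousOn
      ((hΦc.comp_continuous (by fun_prop) fun t => (G t).2).continuousOn)
      (fun t _ => hβk t)
      (fun t _ => by rw [iterate_φ_chain hg k ε δ hδ _ (G t).2, hG])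
      (mem_univ 0) (by simp only [hG0, β.source])
    refine ⟨G 1, (G 1).2, ?_⟩
    have := heq (mem_univ 1)
    simp only [β.target] at this
    exact this.symm

/-- Both `φ ∘ g i` and `φ ∘ g j` lift `φ` through `f`, which is locally injective off the filled
Julia set; agreement at one point would spread to `0`. -/
theorem φ_g_ne (hf : IsGenPolyLike f U' U Ui d)
    (hcrit : ∀ c, IsCriticalPoint f U' c → c ∈ filledJulia f U')
    (hφ : IsUniversalCovering φ (U \ filledJulia f U'))
    (hg : ∀ j, IsInverseLift f U' φ (g j)) {i j : Fin d} (h0 : φ (g i 0) ≠ φ (g j 0))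
    {y : ℂ} (hy : y ∈ disk) : φ (g i y) ≠ φ (g j y) := by
  intro h
  refine h0 ((hf.locInjOn hcrit).eqOn_of_comp_eqOn (S := disk)
    (convex_ball (0 : ℂ) 1).isPreconnected (u := fun z => φ (g i z)) (v := fun z => φ (g j z))
    (hφ.holo.continuousOn.comp (hg i).holo.continuousOn (hg i).mapsTo)
    (hφ.holo.continuousOn.comp (hg j).holo.continuousOn (hg j).mapsTo) ?_ ?_ hy h (by simp))
  · intro z hz
    refine ⟨(hg i).mem_domain z hz, fun hK => (hφ.mapsTo hz).2 ?_⟩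
    rw [← (hg i).lift z hz]
    exact (apply_mem_filledJulia_iff ((hg i).mem_domain z hz)).2 hK
  · intro z hz
    simp only [(hg i).lift z hz, (hg j).lift z hz]

variable {γ : (k : ℕ) → (Fin k → Fin d) → Fin k → ℂ → ℂ}

theorem IsGoodFamily.image_tail (hγ : IsGoodFamily φ g γ) (hg : ∀ j, IsInverseLift f U' φ (g j))
    (k : ℕ) (ε : Fin (k + 1) → Fin d) :
    chain g k (Fin.tail ε) (Fin.tail (γ (k + 1) ε)) '' disk = block g γ k (Fin.tail ε) := by
  rcases Nat.eq_zero_or_pos k with rfl | hk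
  · rfl
  · exact image_congr fun z hz => chain_congr hg k _ _ _ (fun l => hγ.deck _ _ _)
      (fun l => hγ.shift k hk ε l) hz

theorem IsGoodFamily.image_f (hγ : IsGoodFamily φ g γ) (hg : ∀ j, IsInverseLift f U' φ (g j))
    (k : ℕ) (ε : Fin (k + 1) → Fin d) :
    f '' (φ '' block g γ (k + 1) ε) = φ '' block g γ k (Fin.tail ε) := by
  rw [← hγ.image_tail hg, block, image_image, image_image, image_image]
  exact image_congr fun z hz => apply_φ_chain_succ hg (fun l => hγ.deck _ _ _) hz

/-- If blocks with different first letters give the same set, the corresponding component contains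
a critical point. -/
theorem exists_critical_of_block_eq (hf : IsGenPolyLike f U' U Ui d)
    (hcrit : ∀ c, IsCriticalPoint f U' c → c ∈ filledJulia f U')
    (hφ : IsUniversalCovering φ (U \ filledJulia f U'))
    (hg : ∀ j, IsInverseLift f U' φ (g j)) (hg0 : Function.Injective fun j => φ (g j 0))
    (hγ : IsGoodFamily φ g γ) {k : ℕ} {ε ε' : Fin (k + 1) → Fin d}
    (heq : block g γ (k + 1) ε = block g γ (k + 1) ε') (hne : ε 0 ≠ ε' 0) {W : Set ℂ}
    (hW : IsComponentOf W (pullback f U' U (k + 1)))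
    (hWV : φ '' block g γ (k + 1) ε = W \ filledJulia f U') :
    ∃ c ∈ W, IsCriticalPoint f U' c := by
  by_contra! hcon
  have hinj := hf.injOn_component hW hcon
  -- The merging property starts at length `1`; for `k = 0` both blocks are the whole disk.
  have htail : block g γ k (Fin.tail ε) = block g γ k (Fin.tail ε') := by
    rcases Nat.eq_zero_or_pos k with rfl | hk
    · rfl
    · refine hγ.merged k hk _ _ ?_
      rw [← hγ.image_f hg, ← hγ.image_f hg, heq]
  have h0 : (0 : ℂ) ∈ disk := by simp
  set y := chain g k (Fin.tail ε) (Fin.tail (γ (k + 1) ε)) 0 with hy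
  have hyd : y ∈ disk := chain_mapsTo hg k _ _ (fun l => hγ.deck _ _ _) h0
  have hyV : y ∈ chain g k (Fin.tail ε') (Fin.tail (γ (k + 1) ε')) '' disk := by
    rw [hγ.image_tail hg, ← htail, ← hγ.image_tail hg]
    exact ⟨0, h0, rfl⟩
  -- The same `y` is reached by both shifted chains, from `0` and from `z`; prefixing the two first
  -- letters gives two preimages of `φ y` in `W`.
  obtain ⟨z, hz, hzy⟩ := hyV
  have h1 : φ (g (ε 0) y) ∈ W := by
    have : φ (g (ε 0) y) ∈ φ '' block g γ (k + 1) ε :=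
      ⟨_, ⟨0, h0, rfl⟩, φ_chain_succ hg (fun l => hγ.deck _ _ _) h0⟩
    rw [hWV] at this
    exact this.1
  have h2 : φ (g (ε' 0) y) ∈ W := by
    have : φ (g (ε' 0) y) ∈ φ '' block g γ (k + 1) ε' :=
      ⟨_, ⟨z, hz, rfl⟩, by rw [φ_chain_succ hg (fun l => hγ.deck _ _ _) hz, hzy]⟩
    rw [← heq, hWV] at this
    exact this.1
  refine φ_g_ne hf hcrit hφ hg (i := ε 0) (j := ε' 0) (fun h => hne (hg0 h)) hyd (hinj h1 h2 ?_)
  rw [(hg _).lift y hyd, (hg _).lift y hyd]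

theorem isPreconnected_iInter_of_antitone {Z : ℕ → Set ℂ} (hZ : Antitone Z)
    (hc : ∀ n, IsCompact (Z n)) (hp : ∀ n, IsPreconnected (Z n)) : IsPreconnected (⋂ n, Z n) := by
  rw [isPreconnected_closed_iff]
  intro t t' ht ht' hcov h1 h2
  by_contra hcon
  have hI : IsCompact (⋂ n, Z n) := (hc 0).of_isClosed_subset
    (isClosed_iInter fun n => (hc n).isClosed) (iInter_subset _ 0)
  obtain ⟨u, v, hu, hv, htu, htv, huv⟩ := SeparatedNhds.of_isCompact_isCompact
    (hI.inter_right ht) (hI.inter_right ht')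
    (disjoint_left.2 fun x hx hx' => hcon ⟨x, hx.1, hx.2, hx'.2⟩)
  obtain ⟨n, hn⟩ := exists_subset_nhds_of_isCompact (U := u ∪ v)
    (fun i j => ⟨max i j, hZ (le_max_left i j), hZ (le_max_right i j)⟩) hc
    (fun x hx => (hu.union hv).mem_nhds ((hcov hx).elim (fun h => Or.inl (htu ⟨hx, h⟩))
      fun h => Or.inr (htv ⟨hx, h⟩)))
  obtain ⟨x, hx, hxt⟩ := h1
  obtain ⟨x', hx', hxt'⟩ := h2
  obtain ⟨y, -, hyu, hyv⟩ := hp n u v hu hv hn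
    ⟨x, iInter_subset _ n hx, htu ⟨hx, hxt⟩⟩ ⟨x', iInter_subset _ n hx', htv ⟨hx', hxt'⟩⟩
  exact disjoint_left.1 huv hyu hyv

end Chains

/-! ### The point coded by an infinite sequence. -/

section Coding

variable {d N : ℕ} {f : ℂ → ℂ} {U' U : Set ℂ} {Ui : Fin N → Set ℂ} {φ : ℂ → ℂ}
  {g : Fin d → ℂ → ℂ} {γ : (k : ℕ) → (Fin k → Fin d) → Fin k → ℂ → ℂ}

/-- `W k` belongs to the block of length `k + 1`. Nesting of the blocks gives `W k` and `W (k + 1)`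
a common point, and `closure (W (k + 1))` is connected inside `f⁻ᵏ⁻¹(U)`. Removing the filled Julia
set does not change closures, as its complement is dense. -/
theorem exists_components (hf : IsGenPolyLike f U' U Ui d)
    (hKc : IsCompact (filledJulia f U')) (hKt : IsTotallyDisconnected (filledJulia f U'))
    (hcrit : ∀ c, IsCriticalPoint f U' c → c ∈ filledJulia f U')
    (hφ : IsUniversalCovering φ (U \ filledJulia f U'))
    (hg : ∀ j, IsInverseLift f U' φ (g j)) (hγ : IsGoodFamily φ g γ) (ε : ℕ → Fin d) :
    ∃ W : ℕ → Set ℂ, (∀ k, IsComponentOf (W k) (pullback f U' U (k + 1))) ∧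
      (∀ k, φ '' block g γ (k + 1) (fun i => ε i) = W k \ filledJulia f U') ∧
      (∀ k, closure (W (k + 1)) ⊆ W k) ∧
      codeSet φ g γ ε = ⋂ k, closure (W k) := by
  choose W hW hWV using fun k => exists_component_image_chain hf hKc hKt hcrit hφ hg (k + 1)
    (fun i => ε i) (γ (k + 1) fun i => ε i) fun l => hγ.deck _ _ _
  have hWo : ∀ k, IsOpen (W k) := fun k => by
    obtain ⟨z, -, h⟩ := hW k
    rw [h]; exact (hf.isOpen_pullback _).connectedComponentIn
  have hWs : ∀ k, W k ⊆ pullback f U' U (k + 1) := fun k => (hW k).subset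
  have hclo : ∀ k, closure (W k \ filledJulia f U') = closure (W k) := fun k =>
    subset_antisymm (closure_mono sdiff_subset)
      (closure_minimal (subset_closure_diff hKt (hWo k)) isClosed_closure)
  refine ⟨W, hW, hWV, fun k => ?_, ?_⟩
  · have hpt : φ (chain g (k + 2) (fun i => ε i) (γ (k + 2) fun i => ε i) 0) ∈
        φ '' block g γ (k + 2) (fun i => ε i) := ⟨_, ⟨0, by simp, rfl⟩, rfl⟩
    have h1 := hpt
    rw [block, hWV (k + 1)] at h1
    have h2 := image_mono (hγ.nested (k + 1) (by omega) fun i => ε i) hpt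
    have h3 : block g γ (k + 1) (Fin.init fun i : Fin (k + 2) => ε i) =
      block g γ (k + 1) (fun i => ε i) := rfl
    rw [h3, block, hWV k] at h2
    exact (hW k).subset_of_preconnected (hW (k + 1)).isPreconnected.closure
      ((closure_mono (hWs (k + 1))).trans (hf.closure_pullback_subset (k + 1)))
      h2.1 (subset_closure h1.1)
  · ext z
    simp only [codeSet, mem_iInter]
    constructor
    · intro h k
      have := h (k + 1) (by omega)
      rwa [block, hWV k, hclo] at this
    · rintro h (_ | k) hk
      · omega
      · rw [block, hWV k, hclo]
        exact h k

theorem exists_codeSet_eq_singleton (hf : IsGenPolyLike f U' U Ui d)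
    (hKc : IsCompact (filledJulia f U')) (hKt : IsTotallyDisconnected (filledJulia f U'))
    (hcrit : ∀ c, IsCriticalPoint f U' c → c ∈ filledJulia f U')
    (hφ : IsUniversalCovering φ (U \ filledJulia f U'))
    (hg : ∀ j, IsInverseLift f U' φ (g j)) (hγ : IsGoodFamily φ g γ) (ε : ℕ → Fin d) :
    ∃ z ∈ filledJulia f U', codeSet φ g γ ε = {z} := by
  obtain ⟨W, hW, hWV, hnest, hcode⟩ := exists_components hf hKc hKt hcrit hφ hg hγ ε
  have hWs : ∀ k, W k ⊆ pullback f U' U (k + 1) := fun k => (hW k).subset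
  have hcomp : ∀ k, IsCompact (closure (W k)) := fun k =>
    (hf.isCompact_closure_pullback k).of_isClosed_subset isClosed_closure (closure_mono (hWs k))
  have hanti : Antitone fun k => closure (W k) :=
    antitone_nat_of_succ_le fun k => (hnest k).trans subset_closure
  have hpre : IsPreconnected (⋂ k, closure (W k)) :=
    isPreconnected_iInter_of_antitone hanti hcomp fun k => (hW k).isPreconnected.closure
  have hne : (⋂ k, closure (W k)).Nonempty :=
    IsCompact.nonempty_iInter_of_sequence_nonempty_isCompact_isClosed _
      (fun k => hanti (Nat.le_succ k)) (fun k => by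
        obtain ⟨z, hz, h⟩ := hW k
        exact ⟨z, subset_closure (by rw [h]; exact mem_connectedComponentIn hz)⟩)
      (hcomp 0) fun k => isClosed_closure
  -- A point of `closure (W (n + 1))` lies in `W n ⊆ f⁻ⁿ⁻¹(U)`, so its `n`-th iterate is still in
  -- `U'`.
  have hsub : (⋂ k, closure (W k)) ⊆ filledJulia f U' := fun z hz n =>
    iterate_mem_of_mem_pullback (hWs n (hnest n (mem_iInter.1 hz (n + 1))))
  obtain ⟨z, hz⟩ := hne
  exact ⟨z, hsub hz, by rw [hcode]; exact (hKt _ hsub hpre).eq_singleton_of_mem hz⟩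

theorem isCriticalPoint_of_codeSet_eq (hf : IsGenPolyLike f U' U Ui d)
    (hKc : IsCompact (filledJulia f U')) (hKt : IsTotallyDisconnected (filledJulia f U'))
    (hcrit : ∀ c, IsCriticalPoint f U' c → c ∈ filledJulia f U')
    (hφ : IsUniversalCovering φ (U \ filledJulia f U'))
    (hg : ∀ j, IsInverseLift f U' φ (g j)) (hg0 : Function.Injective fun j => φ (g j 0))
    (hγ : IsGoodFamily φ g γ) {ε ε' : ℕ → Fin d} {z : ℂ} (h : codeSet φ g γ ε = {z})
    (h' : codeSet φ g γ ε' = {z}) (hne : ε 0 ≠ ε' 0) : IsCriticalPoint f U' z := by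
  obtain ⟨W, hW, hWV, hnest, hcode⟩ := exists_components hf hKc hKt hcrit hφ hg hγ ε
  obtain ⟨W', hW', hWV', hnest', hcode'⟩ := exists_components hf hKc hKt hcrit hφ hg hγ ε'
  have hz : ∀ k, z ∈ W k := fun k =>
    hnest k (mem_iInter.1 (hcode ▸ h ▸ mem_singleton z) (k + 1))
  have hz' : ∀ k, z ∈ W' k := fun k =>
    hnest' k (mem_iInter.1 (hcode' ▸ h' ▸ mem_singleton z) (k + 1))
  have hWs : ∀ k, W k ⊆ pullback f U' U (k + 1) := fun k => (hW k).subset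
  -- Both components at level `k` contain `z`, so they are equal, and the merging property
  -- identifies the two blocks.
  have hcr : ∀ k, ∃ c ∈ W k, IsCriticalPoint f U' c := fun k =>
    exists_critical_of_block_eq hf hcrit hφ hg hg0 hγ
      (hγ.merged (k + 1) (by omega) (fun i => ε i) (fun i => ε' i)
        (by rw [hWV k, hWV' k, (hW k).eq_of_mem (hW' k) (hz k) (hz' k)])) hne (hW k) (hWV k)
  have hU'o := hf.isOpen_domain
  have hdc : ContinuousOn (deriv f) U' := (hf.holo.deriv hU'o).continuousOn
  -- The index is shifted so that the closure stays inside `W k ⊆ U'`, where `deriv f` is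
  -- continuous; hence `Z k` is closed.
  let Z : ℕ → Set ℂ := fun k => closure (W (k + 1)) ∩ deriv f ⁻¹' {0}
  have hZc : ∀ k, IsClosed (Z k) := fun k =>
    (hdc.mono fun x hx => (hWs k (hnest k hx)).1).preimage_isClosed_of_isClosed isClosed_closure
      isClosed_singleton
  have hZ0 : IsCompact (Z 0) :=
    ((hf.isCompact_closure_pullback 1).of_isClosed_subset isClosed_closure
      (closure_mono (hWs 1))).of_isClosed_subset (hZc 0) inter_subset_left
  obtain ⟨c, hc⟩ := IsCompact.nonempty_iInter_of_sequence_nonempty_isCompact_isClosed Z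
    (fun k => inter_subset_inter_left _ ((hnest (k + 1)).trans subset_closure))
    (fun k => by
      obtain ⟨c, hc, hc'⟩ := hcr (k + 1)
      exact ⟨c, subset_closure hc, hc'.2⟩) hZ0 hZc
  rw [mem_iInter] at hc
  have hcz : c ∈ codeSet φ g γ ε := by
    rw [hcode, mem_iInter]
    exact fun k => subset_closure (hnest k (hc k).1)
  rw [h, mem_singleton_iff] at hcz
  subst hcz
  exact ⟨(hWs 0 (hz 0)).1, (hc 0).2⟩

end Coding

end PolyLike

/-! ### Assembly of the two statements. -/

theorem mainTheorem3 {d N : ℕ} (hd : 1 < d)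
    -- a generalized polynomial-like map whose Julia set is a Cantor set with all critical points
    (f : ℂ → ℂ) (U' U : Set ℂ) (Ui : Fin N → Set ℂ)
    (hf : PolyLike.IsGenPolyLike f U' U Ui d)
    (hKJ : PolyLike.filledJulia f U' = PolyLike.julia f U')
    (hJ : PolyLike.IsCantorSet (PolyLike.julia f U'))
    (hcrit : ∀ c, PolyLike.IsCriticalPoint f U' c → c ∈ PolyLike.julia f U')
    -- the base point and its preimages
    (b : ℂ) (hb : b ∈ U \ U')
    (w : Fin d → ℂ) (hw_inj : Function.Injective w)
    (hw_range : Set.range w = {z | z ∈ U' ∧ f z = b})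
    -- the universal covering and the lifted inverse branches
    (φ : ℂ → ℂ) (hφ : PolyLike.IsUniversalCovering φ (U \ PolyLike.julia f U'))
    (hφ0 : φ 0 = b)
    (g : Fin d → ℂ → ℂ) (hg : ∀ j, PolyLike.IsInverseLift f U' φ (g j))
    (hg0 : ∀ j, φ (g j 0) = w j)
    -- the deck transformations defining the sets `V_ε`
    (γ : (k : ℕ) → (Fin k → Fin d) → Fin k → ℂ → ℂ)
    (hγ : PolyLike.IsGoodFamily φ g γ) :
    (∀ (k : ℕ) (hk : 1 ≤ k) (ε ε' : Fin k → Fin d),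
      PolyLike.block g γ k ε = PolyLike.block g γ k ε' → ε ⟨0, hk⟩ ≠ ε' ⟨0, hk⟩ →
      ∃ W : Set ℂ, PolyLike.IsComponentOf W (PolyLike.pullback f U' U k) ∧
        φ '' PolyLike.block g γ k ε = W \ PolyLike.julia f U' ∧
        ∃ c ∈ W, PolyLike.IsCriticalPoint f U' c) ∧
    ∃ π : (ℕ → Fin d) → ℂ,
      (∀ ε, π ε ∈ PolyLike.julia f U' ∧ PolyLike.codeSet φ g γ ε = {π ε}) ∧
      ∀ (ε ε' : ℕ → Fin d) (z : ℂ), π ε = z → π ε' = z → ε 0 ≠ ε' 0 →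
        PolyLike.IsCriticalPoint f U' z := by
  have hKc : IsCompact (PolyLike.filledJulia f U') := hKJ ▸ hJ.2.1
  have hKt : IsTotallyDisconnected (PolyLike.filledJulia f U') := hKJ ▸ hJ.2.2.2
  rw [← hKJ] at hcrit hφ ⊢
  have hgw : Function.Injective fun j => φ (g j 0) := fun i j h => hw_inj (by
    simpa only [hg0] using h)
  refine ⟨?_, ?_⟩
  · rintro (_ | k) hk ε ε' heq hne
    · omega
    · obtain ⟨W, hW, hWV⟩ := PolyLike.exists_component_image_chain hf hKc hKt hcrit hφ hg (k + 1) ε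
        (γ (k + 1) ε) fun l => hγ.deck _ _ _
      exact ⟨W, hW, hWV,
        PolyLike.exists_critical_of_block_eq hf hcrit hφ hg hgw hγ heq hne hW hWV⟩
  · choose π hπ hcode using
      PolyLike.exists_codeSet_eq_singleton hf hKc hKt hcrit hφ hg hγ
    refine ⟨π, fun ε => ⟨hπ ε, hcode ε⟩, fun ε ε' z h h' hne => ?_⟩
    exact PolyLike.isCriticalPoint_of_codeSet_eq hf hKc hKt hcrit hφ hg hgw hγ
      (h ▸ hcode ε) (h' ▸ hcode ε') hne
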